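/- Let $d\ge 1$ and let $A=\begin{pmatrix}A_{LL}&A_{LR}\\A_{RL}&A_{RR}\end{pmatrix}\in M_{2d}(\mathbb C)$ be Hermitian positive definite, with $d\times d$ blocks. For $z\in\mathbb C^*$ put $\Phi(z)=A_{LL}+A_{RR}+zA_{LR}+z^{-1}A_{RL}$, and for $k\in\mathbb Z$ let $C_k=\frac1{2\pi}\int_0^{2\pi}\Phi(e^{i\theta})^{-1}e^{-ik\theta}\,d\theta\in M_d(\mathbb C)$. Inner products are antilinear in the first argument, and $S^1$ carries $d\theta/2\pi$. For $P\ge 1$ let $X^{(P)}=(X^{(P)}_k)_{k\in\mathbb Z/P\mathbb Z}$ be the $\mathbb C^d$-valued periodic Gaussian Markov process with density proportional to $\exp(-\frac12x^*Q^{(P)}x)$ with respect to Lebesgue measure on $(\mathbb C^d)^{\mathbb Z/P\mathbb Z}$, where $Q^{(P)}$ is the block-circulant matrix with blocks $A_{LL}+A_{RR}$ at the positions $(k,k)$, $A_{LR}$ at $(k,k+1)$ and $A_{RL}$ at $(k+1,k)$ (blocks at the same position are added). 1. The density is normalizable for every $P\geq 1$, and for every finitely supported family $(\alpha_k)_{k\in\mathbb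 Z}$ in $\mathbb C^d$, $$\lim_{P\to\infty}\mathbb E\Big[\exp\Big(i\,\mathrm{Re}\sum_k\langle\alpha_k,X^{(P)}_{k\bmod P}\rangle\Big)\Big]=\exp\Big(-\tfrac12\sum_{k,l}\langle\alpha_k,C_{l-k}\alpha_l\rangle\Big).$$ 2. Let $H$ be $L^2(S^1,\mathbb C^d)$ with the inner product $\langle f,g\rangle_H=\langle f,\Phi^{-1}g\rangle_{L^2}$. There are a probability space $(\Omega,\mathcal F,\mathbb P)$ and a $\mathbb C$-linear isometry $X:H\to L^2(\Omega,\mathcal F,\mathbb P;\mathbb C)$ such that $(X(f))_{f\in H}$ is a circularly symmetric complex Gaussian process. 3. For every probability space and every such isometry $X$, put $X_k=(X(e^{ik\bullet}e_j))_{j=1}^d$ for $k\in\mathbb Z$, where $(e_j)$ is the canonical basis of $\mathbb C^d$. Then: - $(X_k)_{k\in\mathbb Z}$ is a Gaussian process, its law is invariant under the translations of $\mathbb Z$, and $\mathbb E[X_kX_l^*]=C_{l-k}^{\mathsf T}$ for all $k,l\in\mathbb{Z}$; - the process $Y_k=\sqrt2\,\overline{X_{-k}}$, $k\in\mathbb Z$,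 is the thermodynamic limit of the periodic processes: for every finite $S\subset\mathbb Z$, $(X^{(P)}_{k\bmod P})_{k\in S}$ converges in law to $(Y_k)_{k\in S}$ as $P\to\infty$; - $(X_k)_{k\in\mathbb Z}$ and $(Y_k)_{k\in\mathbb Z}$ have the Markov property. Here a process $(Z_k)_{k\in\mathbb Z}$ has the Markov property if (a) and (b) hold. (a) Let $D$ be any finite set of edges $\{k,k+1\}$ of $\mathbb Z$. For a set $F$ of edges, $V(F)$ is the set of end points of edges in $F$, $\partial F$ is the set of vertices that belong to exactly one edge of $F$, and $Z^{(F)}=(Z_v)_{v\in V(F)}$. For every partition of $D$ into finitely many nonempty sets $D_i$, $i\in I$, and all bounded measurable complex functions $h_i$ on $(\mathbb C^d)^{V(D_i)}$, almost surely, $$\mathbb E\Big[\prod_{i\in I}h_i(Z^{(D_i)})\,\Big|\,\sigma\big(Z_v;v\in\textstyle\bigcup_{i\in I}\partial D_i\big)\Big]=\prod_{i\in I}\mathbb E\big[h_i(Z^{(D_i)})\,\big|\,\sigma(Z_v;v\in\partial D_i)\big].$$ (b) For every $m\in\mathbb Z$ and all finite sets $S\subset\{k:k<m\}$ and $T\subset\{l:l>m\}$,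 the families $(Z_k)_{k\in S}$ and $(Z_l)_{l\in T}$ are conditionally independent given $Z_m$. -/

import Mathlib

open MeasureTheory ProbabilityTheory Filter Topology ComplexOrder

noncomputable section

namespace GaussMarkov

/-! ### The symbol and its Fourier coefficients -/

instance two_pi_pos_fact : Fact (0 < 2 * Real.pi) := ⟨Real.two_pi_pos⟩

/-- The circle `S¹`, parametrised by the angle `θ ∈ ℝ / 2πℤ`. -/
abbrev Torus : Type := AddCircle (2 * Real.pi)

/-- The matrix-valued function `Φ_A(z) = A_LL + A_RR + z A_LR + z⁻¹ A_RL`, where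
`A = [[A_LL, A_LR], [A_RL, A_RR]]`. -/
def symbol {d : ℕ} (A : Matrix (Fin d ⊕ Fin d) (Fin d ⊕ Fin d) ℂ) (z : ℂ) :
    Matrix (Fin d) (Fin d) ℂ :=
  A.toBlocks₁₁ + A.toBlocks₂₂ + z • A.toBlocks₁₂ + z⁻¹ • A.toBlocks₂₁

/-- `C_k = (2π)⁻¹ ∫₀^{2π} Φ_A(e^{iθ})⁻¹ e^{-ikθ} dθ`, the `k`-th Fourier coefficient of `Φ_A⁻¹`
(entrywise integral). -/
def invCoeff {d : ℕ} (A : Matrix (Fin d ⊕ Fin d) (Fin d ⊕ Fin d) ℂ) (k : ℤ) :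
    Matrix (Fin d) (Fin d) ℂ :=
  Matrix.of fun i j =>
    ((2 * Real.pi : ℝ) : ℂ)⁻¹ * ∫ θ in (0 : ℝ)..(2 * Real.pi),
      (symbol A (Complex.exp (Complex.I * θ)))⁻¹ i j * Complex.exp (-(Complex.I * k * θ))

/-! ### Periodic Gaussian Markov processes -/

/-- The block-circulant matrix on `ℤ/Pℤ` with diagonal blocks `A_LL + A_RR`, blocks `A_LR` at the
positions `(k, k + 1)` and blocks `A_RL` at the positions `(k + 1, k)`. -/
def periodicMatrix {d : ℕ} (A : Matrix (Fin d ⊕ Fin d) (Fin d ⊕ Fin d) ℂ) (P : ℕ) :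
    Matrix (ZMod P × Fin d) (ZMod P × Fin d) ℂ :=
  Matrix.of fun a b =>
    (if b.1 = a.1 then A.toBlocks₁₁ a.2 b.2 + A.toBlocks₂₂ a.2 b.2 else 0)
      + (if b.1 = a.1 + 1 then A.toBlocks₁₂ a.2 b.2 else 0)
      + (if a.1 = b.1 + 1 then A.toBlocks₂₁ a.2 b.2 else 0)

/-- The unnormalised density `exp(-x^* Q x / 2)` with `Q = periodicMatrix A P`. -/
def periodicWeight {d : ℕ} (A : Matrix (Fin d ⊕ Fin d) (Fin d ⊕ Fin d) ℂ) (P : ℕ) [NeZero P]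
    (x : ZMod P → Fin d → ℂ) : ENNReal :=
  ENNReal.ofReal (Real.exp (-(1 / 2 : ℝ) *
    ∑ a : ZMod P × Fin d, ∑ b : ZMod P × Fin d,
      (star (x a.1 a.2) * periodicMatrix A P a b * x b.1 b.2).re))

/-- The law on `(ℂ^d)^{ℤ/Pℤ}` of the periodic Gaussian Markov process: its density with respect to
Lebesgue measure is proportional to `periodicWeight A P`. -/
def periodicLaw {d : ℕ} (A : Matrix (Fin d ⊕ Fin d) (Fin d ⊕ Fin d) ℂ) (P : ℕ) [NeZero P] :
    Measure (ZMod P → Fin d → ℂ) :=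
  (∫⁻ x, periodicWeight A P x)⁻¹ • (volume : Measure (ZMod P → Fin d → ℂ)).withDensity
    (periodicWeight A P)

/-! ### The Gaussian process as an isometry -/

/-- `L²(S¹, ℂ^d)` for the normalised Lebesgue measure `dθ / 2π`. -/
abbrev SymbolSpace (d : ℕ) : Type :=
  Lp (EuclideanSpace ℂ (Fin d)) 2 (AddCircle.haarAddCircle : Measure Torus)

/-- The inner product `⟨f, Φ_A⁻¹ g⟩` of `L²(S¹, ℂ^d)`, antilinear in `f`. -/
def symbolInner {d : ℕ} (A : Matrix (Fin d ⊕ Fin d) (Fin d ⊕ Fin d) ℂ) (f g : SymbolSpace d) : ℂ :=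
  ∫ θ : Torus, inner ℂ (f θ)
    (Matrix.toEuclideanLin (symbol A (AddCircle.toCircle θ : ℂ))⁻¹ (g θ)) ∂AddCircle.haarAddCircle

/-- The function `θ ↦ e^{ikθ} e_i` in `L²(S¹, ℂ^d)`. -/
def waveVec {d : ℕ} (k : ℤ) (i : Fin d) : SymbolSpace d :=
  ContinuousMap.toLp 2 AddCircle.haarAddCircle ℂ
    ⟨fun θ : Torus => fourier k θ • EuclideanSpace.single i (1 : ℂ), by fun_prop⟩

/-- `X` is a linear isometry of `L²(S¹, ℂ^d)`, with the norm `⟨f, Φ_A⁻¹ f⟩^{1/2}`, into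
`L²(Ω, μ; ℂ)`, whose values form a circularly symmetric complex Gaussian process.
(As `X` is linear, circular symmetry of each `X f` is that of the whole family; it also implies
that the family is centred.) -/
structure IsGaussianIsometry {d : ℕ} (A : Matrix (Fin d ⊕ Fin d) (Fin d ⊕ Fin d) ℂ)
    {Ω : Type*} [MeasurableSpace Ω] (μ : Measure Ω) (X : SymbolSpace d →ₗ[ℂ] Lp ℂ 2 μ) : Prop where
  isometry : ∀ f, ((‖X f‖ ^ 2 : ℝ) : ℂ) = symbolInner A f f
  gaussian : IsGaussianProcess (fun f ω => X f ω) μ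
  circular : ∀ (φ : ℝ) (f : SymbolSpace d),
    μ.map (fun ω => Complex.exp (Complex.I * φ) * X f ω) = μ.map (fun ω => X f ω)

/-- The process `X_k = (X(e^{ik•} e_i))_i` on `ℤ`. -/
def gibbsProcess {d : ℕ} {Ω : Type*} [MeasurableSpace Ω] {μ : Measure Ω}
    (X : SymbolSpace d →ₗ[ℂ] Lp ℂ 2 μ) (k : ℤ) (ω : Ω) : Fin d → ℂ :=
  fun i => X (waveVec k i) ω

/-- The process `√2 · conj X_{-k}`. The isometry gives `E[X_k X_l^*] = (C_{l-k})ᵀ`, so that this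
process has `E[Y_k Y_l^*] = 2 C_{l-k}`, the covariance that belongs to densities of the form
`exp(-x^* Q x / 2)` on a complex vector space. -/
def limitProcess {d : ℕ} {Ω : Type*} [MeasurableSpace Ω] {μ : Measure Ω}
    (X : SymbolSpace d →ₗ[ℂ] Lp ℂ 2 μ) (k : ℤ) (ω : Ω) : Fin d → ℂ :=
  fun i => (Real.sqrt 2 : ℂ) * star (gibbsProcess X (-k) ω i)

/-! ### The spatial Markov property

The edge `{k, k + 1}` of the lattice `ℤ` is represented by its left vertex `k`, so that a finite
domain, i.e. a finite set of edges, is a `Finset ℤ`. -/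

/-- The vertices of a finite domain. -/
def vertices (D : Finset ℤ) : Finset ℤ := D ∪ D.image (· + 1)

/-- The boundary of a finite domain: the vertices that belong to exactly one of its edges. -/
def boundary (D : Finset ℤ) : Finset ℤ := (vertices D).filter fun v =>
  (v ∈ D ∧ v - 1 ∉ D) ∨ (v ∉ D ∧ v - 1 ∈ D)

/-- `σ(X_v ; v ∈ S)`. -/
abbrev sigmaOf {Ω G : Type*} [MeasurableSpace G] (X : ℤ → Ω → G) (S : Finset ℤ) : MeasurableSpace Ω :=
  ⨆ v ∈ S, MeasurableSpace.comap (X v) inferInstance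

/-- The spatial Markov property on the finite domain `D`: for every partition `(D_i)` of `D` into
finitely many nonempty domains and all bounded measurable `h_i`,
`E[∏ h_i(X^{(D_i)}) | σ(X_v ; v ∈ ⋃ ∂D_i)] = ∏ E[h_i(X^{(D_i)}) | σ(X_v ; v ∈ ∂D_i)]` a.s. -/
def IsMarkovOn {Ω G : Type*} [MeasurableSpace Ω] [MeasurableSpace G] (μ : Measure Ω)
    (X : ℤ → Ω → G) (D : Finset ℤ) : Prop :=
  ∀ (n : ℕ) (E : Fin n → Finset ℤ), (∀ i, (E i).Nonempty) →
    Pairwise (fun i j => Disjoint (E i) (E j)) → Finset.univ.biUnion E = D →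
    ∀ h : (i : Fin n) → ({v // v ∈ vertices (E i)} → G) → ℂ,
      (∀ i, Measurable (h i)) → (∀ i, ∃ c : ℝ, ∀ x, ‖h i x‖ ≤ c) →
      condExp (sigmaOf X (Finset.univ.biUnion fun i => boundary (E i))) μ
          (fun ω => ∏ i, h i fun v => X v ω)
        =ᵐ[μ] fun ω => ∏ i, condExp (sigmaOf X (boundary (E i))) μ (fun ω' => h i fun v => X v ω') ω

/-- Past and future are independent given the present: for every `m`, all finite sets `S` of sites
to the left of `m` and `T` to the right of `m` and all bounded measurable `f`, `g`,
`E[f(X_S) g(X_T) | X_m] = E[f(X_S) | X_m] E[g(X_T) | X_m]` a.s. -/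
def SplitsAtSites {Ω G : Type*} [MeasurableSpace Ω] [MeasurableSpace G] (μ : Measure Ω)
    (X : ℤ → Ω → G) : Prop :=
  ∀ (m : ℤ) (S T : Finset ℤ), (∀ k ∈ S, k < m) → (∀ l ∈ T, m < l) →
    ∀ (f : ({v // v ∈ S} → G) → ℂ) (g : ({v // v ∈ T} → G) → ℂ), Measurable f → Measurable g →
      (∃ c : ℝ, ∀ x, ‖f x‖ ≤ c) → (∃ c : ℝ, ∀ x, ‖g x‖ ≤ c) →
      condExp (sigmaOf X {m}) μ (fun ω => f (fun v => X v ω) * g (fun v => X v ω))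
        =ᵐ[μ] fun ω => condExp (sigmaOf X {m}) μ (fun ω' => f fun v => X v ω') ω *
          condExp (sigmaOf X {m}) μ (fun ω' => g fun v => X v ω') ω

/-- A family of random variables indexed by `ℤ` is Markov if it has the spatial Markov property on
every finite domain, and its past and future are independent given the present. (The first property
alone does not exclude an interaction between the two ends of a domain.) -/
def IsMarkov {Ω G : Type*} [MeasurableSpace Ω] [MeasurableSpace G] (μ : Measure Ω)
    (X : ℤ → Ω → G) : Prop :=
  (∀ k, Measurable (X k)) ∧ (∀ D : Finset ℤ, IsMarkovOn μ X D) ∧ SplitsAtSites μ X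

/-- The law of the process does not change under translations of `ℤ`. -/
def IsTranslationInvariant {Ω G : Type*} [MeasurableSpace Ω] [MeasurableSpace G] (μ : Measure Ω)
    (X : ℤ → Ω → G) : Prop :=
  ∀ n : ℤ, μ.map (fun ω (k : ℤ) => X (k + n) ω) = μ.map (fun ω (k : ℤ) => X k ω)

/-- `Y` is the thermodynamic limit of the periodic processes: for every finite set `S` of sites,
the law of `(x_{k mod P})_{k ∈ S}` under the periodic law of size `P` converges weakly, as `P → ∞`,
to the law of `(Y_k)_{k ∈ S}`. (The size is written `P + 1` to keep it positive.) -/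
def IsThermodynamicLimit {d : ℕ} (A : Matrix (Fin d ⊕ Fin d) (Fin d ⊕ Fin d) ℂ)
    {Ω : Type*} [MeasurableSpace Ω] (μ : Measure Ω) (Y : ℤ → Ω → Fin d → ℂ) : Prop :=
  ∀ (S : Finset ℤ) (g : BoundedContinuousFunction ({k // k ∈ S} → Fin d → ℂ) ℝ),
    Tendsto
      (fun P : ℕ => ∫ x, g (fun k => x ((k : ℤ) : ZMod (P + 1))) ∂(periodicLaw A (P + 1)))
      atTop (𝓝 (∫ ω, g (fun k => Y k ω) ∂μ))

end GaussMarkov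

end

/-! Positivity is local. On the unit circle the quadratic form of Φ(z) at v is that of A at (v, zv),
so Φ(z) is positive definite and Φ⁻¹ is continuous. Likewise the form of Q^(P) is the sum over the
edges of the form of A at (x_k, x_{k+1}), so the periodic density is a normalizable Gaussian. The
discrete Fourier transform turns Q^(P) into the values of Φ at the P-th roots of unity. The blocks
of its inverse are therefore Riemann sums for the C_{l-k} (`periodicMatrix_inv_apply`,
`tendsto_average_rootPoint`), and the characteristic functions converge.

Multiplication by Φ⁻¹ is a positive operator S^* S. Sending a Hilbert basis of L² to independent
normalised complex Gaussians gives an isometry J, and X = J ∘ S is as required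
(`exists_gaussian_linearIsometry`). Conversely, every circular Gaussian linear family satisfies E
exp(i Re X(f)) = exp(-‖X(f)‖²/4) (`hasGaussianCharFun`), so norms determine laws. Translation
invariance and the thermodynamic limit become computations with the vectors e^{ikθ} e_j.

The Markov property rests on two facts: Φ has only the degrees -1, 0, 1, so Φ e^{ikθ} e_j involves
only the sites k and k ± 1; and ⟨Φf, g⟩_H = ⟨f, g⟩_{L²}, so these vectors are dual to the waves. Let
V be a region containing all neighbours of its interior I. Project a wave at a site of V, in H, onto
the closed span of the Φ e^{iaθ} e_j with a in I. The projection is H-orthogonal to all sites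
outside I. The remainder lives on V and is L²-orthogonal to I, so it is a combination of waves at
the boundary V \ I (`exists_regression`). Each X_v is thus a linear function of boundary values plus
a noise, and orthogonality makes the noises independent of all boundary values and of the noises of
other regions. Conditioning on the boundary integrates out independent noises, which gives the
product formula (`condExp_prod_eq_prod_condExp`). -/

noncomputable section

namespace GaussMarkov

/-! ### The symbol -/

section Symbol

variable {d : ℕ} {A : Matrix (Fin d ⊕ Fin d) (Fin d ⊕ Fin d) ℂ}

/-- Since z⁻¹ is the conjugate of z, the two off-diagonal blocks acquire the factors z and z⁻¹, and
the factors of the lower right block cancel. This transfers positivity from A to Φ(z). -/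
lemma star_dotProduct_symbol_mulVec {z : ℂ} (hz : ‖z‖ = 1) (v w : Fin d → ℂ) :
    star v ⬝ᵥ (symbol A z).mulVec w =
      star (Sum.elim v (z • v)) ⬝ᵥ A.mulVec (Sum.elim w (z • w)) := by
  have hz' : z⁻¹ = star z := by
    rw [Complex.inv_def, Complex.normSq_eq_norm_sq, hz]; simp
  have hzz : star z * z = 1 := by
    rw [← hz']; exact inv_mul_cancel₀ (by rintro rfl; simp at hz)
  have hstar : star (Sum.elim v (z • v)) = Sum.elim (star v) (star z • star v) := by
    ext (i | i) <;> simp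
  conv_rhs => rw [← A.fromBlocks_toBlocks, hstar, Matrix.fromBlocks_mulVec,
    sumElim_dotProduct_sumElim]
  simp only [symbol, hz', Matrix.add_mulVec, Matrix.smul_mulVec, dotProduct_add, dotProduct_smul,
    Sum.elim_comp_inl, Sum.elim_comp_inr, Matrix.mulVec_smul, smul_dotProduct, smul_eq_mul]
  have : star z * (z * (star v ⬝ᵥ A.toBlocks₂₂.mulVec w)) = star v ⬝ᵥ A.toBlocks₂₂.mulVec w := by
    rw [← mul_assoc, hzz, one_mul]
  linear_combination -this

lemma posDef_symbol (hA : A.PosDef) {z : ℂ} (hz : ‖z‖ = 1) : (symbol A z).PosDef := by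
  have hz' : z⁻¹ = star z := by
    rw [Complex.inv_def, Complex.normSq_eq_norm_sq, hz]; simp
  refine Matrix.PosDef.of_dotProduct_mulVec_pos ?_ fun v hv => ?_
  · have h := hA.isHermitian
    rw [← A.fromBlocks_toBlocks, Matrix.isHermitian_fromBlocks_iff] at h
    obtain ⟨h1, h2, h3, h4⟩ := h
    rw [Matrix.IsHermitian, symbol, hz']
    simp only [Matrix.conjTranspose_add, Matrix.conjTranspose_smul, h1.eq, h2, h3, h4.eq, star_star]
    abel
  · rw [star_dotProduct_symbol_mulVec hz]
    refine hA.dotProduct_mulVec_pos fun h => hv ?_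
    ext i
    exact congrFun h (Sum.inl i)

lemma isUnit_symbol (hA : A.PosDef) {z : ℂ} (hz : ‖z‖ = 1) : IsUnit (symbol A z) :=
  (posDef_symbol hA hz).isUnit

lemma isUnit_det_symbol (hA : A.PosDef) {z : ℂ} (hz : ‖z‖ = 1) : IsUnit (symbol A z).det :=
  (Matrix.isUnit_iff_isUnit_det _).1 (isUnit_symbol hA hz)

/-- The inverse is the adjugate divided by the determinant; both are polynomial in the entries, and
the determinant has no zero on the circle. -/
lemma continuousOn_symbol_inv (hA : A.PosDef) :
    ContinuousOn (fun z => (symbol A z)⁻¹) (Metric.sphere 0 1) := by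
  have hs : ContinuousOn (symbol A) (Metric.sphere 0 1) := by
    have h0 : ∀ z ∈ Metric.sphere (0 : ℂ) 1, z ≠ 0 := by
      rintro z hz rfl; simp at hz
    unfold symbol
    fun_prop (disch := assumption)
  have e : (fun z => (symbol A z)⁻¹) = fun z => ((symbol A z).det)⁻¹ • (symbol A z).adjugate := by
    ext1 z; rw [Matrix.inv_def, Ring.inverse_eq_inv']
  rw [e]
  have h1 : Continuous fun M : Matrix (Fin d) (Fin d) ℂ => M.det := continuous_id.matrix_det
  have h2 : Continuous fun M : Matrix (Fin d) (Fin d) ℂ => M.adjugate :=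
    continuous_id.matrix_adjugate
  exact ((h1.comp_continuousOn hs).inv₀ fun z hz =>
    (isUnit_det_symbol hA (by simpa using hz)).ne_zero).smul (h2.comp_continuousOn hs)

lemma norm_toCircle (θ : Torus) : ‖(AddCircle.toCircle θ : ℂ)‖ = 1 := Circle.norm_coe _

lemma continuous_symbol_toCircle :
    Continuous fun θ : Torus => symbol A (AddCircle.toCircle θ : ℂ) := by
  have h0 : ∀ θ : Torus, (AddCircle.toCircle θ : ℂ) ≠ 0 := fun θ => Circle.coe_ne_zero _
  have h1 : Continuous fun θ : Torus => (AddCircle.toCircle θ : ℂ) :=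
    continuous_subtype_val.comp AddCircle.continuous_toCircle
  unfold symbol
  fun_prop (disch := assumption)

lemma continuous_symbol_inv_toCircle (hA : A.PosDef) :
    Continuous fun θ : Torus => (symbol A (AddCircle.toCircle θ : ℂ))⁻¹ :=
  (continuousOn_symbol_inv hA).comp_continuous
    (continuous_subtype_val.comp AddCircle.continuous_toCircle) fun θ => by
      simpa using norm_toCircle θ

end Symbol

/-! ### Multiplication operators on `L²(S¹, ℂ^d)` -/

section MulOp

variable {d : ℕ}

lemma continuous_toEuclideanCLM {F : Torus → Matrix (Fin d) (Fin d) ℂ} (hF : Continuous F) :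
    Continuous fun θ => Matrix.toEuclideanCLM (n := Fin d) (𝕜 := ℂ) (F θ) :=
  (LinearMap.continuous_of_finiteDimensional
    (Matrix.toEuclideanCLM (n := Fin d) (𝕜 := ℂ)).toAlgEquiv.toLinearMap).comp hF

/-- Multiplication by a continuous matrix-valued function. -/
def mulOp (F : Torus → Matrix (Fin d) (Fin d) ℂ) (hF : Continuous F) :
    SymbolSpace d →L[ℂ] SymbolSpace d :=
  ContinuousLinearMap.holderL AddCircle.haarAddCircle ⊤ 2 2
    (ContinuousLinearMap.id ℂ (EuclideanSpace ℂ (Fin d) →L[ℂ] EuclideanSpace ℂ (Fin d)))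
    (ContinuousMap.toLp ⊤ AddCircle.haarAddCircle ℂ ⟨_, continuous_toEuclideanCLM hF⟩)

lemma coeFn_mulOp (F : Torus → Matrix (Fin d) (Fin d) ℂ) (hF : Continuous F) (f : SymbolSpace d) :
    mulOp F hF f =ᵐ[AddCircle.haarAddCircle] fun θ => Matrix.toEuclideanLin (F θ) (f θ) := by
  have h1 := ContinuousLinearMap.coeFn_holder (r := 2)
    (ContinuousLinearMap.id ℂ (EuclideanSpace ℂ (Fin d) →L[ℂ] EuclideanSpace ℂ (Fin d)))
    (ContinuousMap.toLp ⊤ AddCircle.haarAddCircle ℂ ⟨_, continuous_toEuclideanCLM hF⟩) f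
  have h2 := ContinuousMap.coeFn_toLp (p := ⊤) (𝕜 := ℂ) (AddCircle.haarAddCircle : Measure Torus)
    ⟨_, continuous_toEuclideanCLM hF⟩
  filter_upwards [h1, h2] with θ h1 h2
  refine h1.trans ?_
  rw [h2]
  rfl

lemma mulOp_mulOp {F G : Torus → Matrix (Fin d) (Fin d) ℂ} (hF : Continuous F) (hG : Continuous G)
    (h : ∀ θ, F θ * G θ = 1) (f : SymbolSpace d) : mulOp F hF (mulOp G hG f) = f := by
  apply Lp.ext
  filter_upwards [coeFn_mulOp F hF (mulOp G hG f), coeFn_mulOp G hG f] with θ h1 h2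
  rw [h1, h2, Matrix.toLpLin_apply, Matrix.toLpLin_apply]
  simp [h θ]

lemma inner_mulOp (F : Torus → Matrix (Fin d) (Fin d) ℂ) (hF : Continuous F)
    (f g : SymbolSpace d) :
    inner ℂ f (mulOp F hF g) =
      ∫ θ, inner ℂ (f θ) (Matrix.toEuclideanLin (F θ) (g θ)) ∂AddCircle.haarAddCircle := by
  rw [L2.inner_def]
  refine integral_congr_ae ?_
  filter_upwards [coeFn_mulOp F hF g] with θ h
  rw [h]

lemma inner_mulOp_left (F : Torus → Matrix (Fin d) (Fin d) ℂ) (hF : Continuous F)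
    (f g : SymbolSpace d) :
    inner ℂ (mulOp F hF f) g =
      ∫ θ, inner ℂ (Matrix.toEuclideanLin (F θ) (f θ)) (g θ) ∂AddCircle.haarAddCircle := by
  rw [L2.inner_def]
  refine integral_congr_ae ?_
  filter_upwards [coeFn_mulOp F hF f] with θ h
  rw [h]

lemma mulOp_nonneg {F : Torus → Matrix (Fin d) (Fin d) ℂ} (hF : Continuous F)
    (h : ∀ θ, (F θ).PosSemidef) : 0 ≤ mulOp F hF := by
  rw [ContinuousLinearMap.nonneg_iff_isPositive, ContinuousLinearMap.isPositive_def]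
  have hp : ∀ θ, (Matrix.toEuclideanLin (F θ)).IsPositive := fun θ =>
    Matrix.isPositive_toEuclideanLin_iff.2 (h θ)
  constructor
  · intro f g
    change inner ℂ (mulOp F hF f) g = inner ℂ f (mulOp F hF g)
    rw [inner_mulOp, inner_mulOp_left]
    exact integral_congr_ae (.of_forall fun θ => (hp θ).isSymmetric _ _)
  · intro f
    rw [ContinuousLinearMap.reApplyInnerSelf, L2.inner_def]
    rw [← integral_re (L2.integrable_inner _ _)]
    refine integral_nonneg_of_ae ?_
    filter_upwards [coeFn_mulOp F hF f] with θ h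
    rw [h]
    exact (hp θ).2 _

end MulOp

/-! ### The covariance and precision operators -/

section Operators

variable {d : ℕ} {A : Matrix (Fin d ⊕ Fin d) (Fin d ⊕ Fin d) ℂ}

/-- Multiplication by `Φ_A⁻¹`. -/
def covOp (hA : A.PosDef) : SymbolSpace d →L[ℂ] SymbolSpace d :=
  mulOp _ (continuous_symbol_inv_toCircle hA)

/-- Multiplication by `Φ_A`. -/
def precOp (A : Matrix (Fin d ⊕ Fin d) (Fin d ⊕ Fin d) ℂ) : SymbolSpace d →L[ℂ] SymbolSpace d :=
  mulOp _ (continuous_symbol_toCircle (A := A))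

lemma symbolInner_eq (hA : A.PosDef) (f g : SymbolSpace d) :
    symbolInner A f g = inner ℂ f (covOp hA g) :=
  (inner_mulOp _ _ _ _).symm

lemma precOp_covOp (hA : A.PosDef) (f : SymbolSpace d) : precOp A (covOp hA f) = f :=
  mulOp_mulOp _ _
    (fun θ => Matrix.mul_nonsing_inv _ (isUnit_det_symbol hA (norm_toCircle θ))) f

lemma covOp_precOp (hA : A.PosDef) (f : SymbolSpace d) : covOp hA (precOp A f) = f :=
  mulOp_mulOp _ _
    (fun θ => Matrix.nonsing_inv_mul _ (isUnit_det_symbol hA (norm_toCircle θ))) f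

lemma covOp_nonneg (hA : A.PosDef) : 0 ≤ covOp hA :=
  mulOp_nonneg _ fun θ => (posDef_symbol hA (norm_toCircle θ)).inv.posSemidef

lemma inner_covOp_left (hA : A.PosDef) (f g : SymbolSpace d) :
    inner ℂ (covOp hA f) g = inner ℂ f (covOp hA g) :=
  ((ContinuousLinearMap.nonneg_iff_isPositive _).1 (covOp_nonneg hA)).isSymmetric f g

/-- The weight Φ⁻¹ cancels Φ. Hence the vectors Φ e^{ikθ} e_i form the system dual to the waves for
the inner product of H. -/
lemma symbolInner_precOp_left (hA : A.PosDef) (f g : SymbolSpace d) :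
    symbolInner A (precOp A f) g = inner ℂ f g := by
  rw [symbolInner_eq hA, ← inner_covOp_left, covOp_precOp]

/-- A positive operator `T` on a Hilbert space is of the form `S^* S`. -/
lemma exists_inner_eq_of_nonneg {H : Type*} [NormedAddCommGroup H] [InnerProductSpace ℂ H]
    [CompleteSpace H] {T : H →L[ℂ] H} (hT : 0 ≤ T) :
    ∃ S : H →L[ℂ] H, ∀ f g, inner ℂ (S f) (S g) = inner ℂ f (T g) := by
  obtain ⟨S, hS⟩ := CStarAlgebra.nonneg_iff_eq_star_mul_self.1 hT
  refine ⟨S, fun f g => ?_⟩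
  rw [hS, ContinuousLinearMap.star_eq_adjoint, mul_apply_eq_comp,
    ContinuousLinearMap.adjoint_inner_right]

/-- A square root of the inner product `symbolInner A`. -/
lemma exists_inner_eq_symbolInner (hA : A.PosDef) :
    ∃ S : SymbolSpace d →L[ℂ] SymbolSpace d, ∀ f g, inner ℂ (S f) (S g) = symbolInner A f g := by
  obtain ⟨S, hS⟩ := exists_inner_eq_of_nonneg (covOp_nonneg hA)
  exact ⟨S, fun f g => by rw [hS, symbolInner_eq hA]⟩

lemma mulOp_toLp {F : Torus → Matrix (Fin d) (Fin d) ℂ} (hF : Continuous F)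
    (f g : C(Torus, EuclideanSpace ℂ (Fin d)))
    (h : ∀ θ, g θ = Matrix.toEuclideanLin (F θ) (f θ)) :
    mulOp F hF (ContinuousMap.toLp 2 AddCircle.haarAddCircle ℂ f) =
      ContinuousMap.toLp 2 AddCircle.haarAddCircle ℂ g := by
  apply Lp.ext
  filter_upwards [coeFn_mulOp F hF (ContinuousMap.toLp 2 AddCircle.haarAddCircle ℂ f),
    ContinuousMap.coeFn_toLp (p := 2) (𝕜 := ℂ) (AddCircle.haarAddCircle : Measure Torus) f,
    ContinuousMap.coeFn_toLp (p := 2) (𝕜 := ℂ) (AddCircle.haarAddCircle : Measure Torus) g]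
    with θ h1 h2 h3
  rw [h1, h2, h3, h]

/-- The continuous function `θ ↦ e^{ikθ} e_i`. -/
def wave {d : ℕ} (k : ℤ) (i : Fin d) : C(Torus, EuclideanSpace ℂ (Fin d)) :=
  ⟨fun θ : Torus => fourier k θ • EuclideanSpace.single i (1 : ℂ), by fun_prop⟩

lemma wave_apply (k : ℤ) (i : Fin d) (θ : Torus) (j : Fin d) :
    wave k i θ j = if j = i then fourier k θ else 0 := by
  simp [wave]

lemma toLp_wave (k : ℤ) (i : Fin d) :
    ContinuousMap.toLp 2 AddCircle.haarAddCircle ℂ (wave k i) = waveVec k i := rfl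

lemma coeFn_waveVec (k : ℤ) (i : Fin d) :
    waveVec k i =ᵐ[AddCircle.haarAddCircle] wave k i :=
  ContinuousMap.coeFn_toLp _ _

lemma toCircle_mul_fourier (k : ℤ) (θ : Torus) :
    (AddCircle.toCircle θ : ℂ) * fourier k θ = fourier (k + 1) θ := by
  rw [fourier_add, fourier_one, mul_comm]

lemma inv_toCircle_mul_fourier (k : ℤ) (θ : Torus) :
    (AddCircle.toCircle θ : ℂ)⁻¹ * fourier k θ = fourier (k - 1) θ := by
  rw [← Circle.coe_inv, ← AddCircle.toCircle_neg, sub_eq_add_neg, fourier_add, mul_comm]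
  simp [fourier_apply]

/-- The locality behind the Markov property: Φ is a Laurent polynomial of degrees -1, 0, 1, so it
couples a site to its nearest neighbours only. -/
lemma precOp_waveVec (k : ℤ) (j : Fin d) :
    precOp A (waveVec k j) = ∑ i, ((A.toBlocks₁₁ i j + A.toBlocks₂₂ i j) • waveVec k i +
      A.toBlocks₁₂ i j • waveVec (k + 1) i + A.toBlocks₂₁ i j • waveVec (k - 1) i) := by
  simp_rw [← toLp_wave, ← map_smul, ← map_add, ← map_sum]
  refine mulOp_toLp _ _ _ fun θ => ?_
  ext m
  simp only [ContinuousMap.coe_sum, ContinuousMap.coe_add, ContinuousMap.coe_smul, 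
    Matrix.toLpLin_apply, Finset.sum_apply, Pi.add_apply, Pi.smul_apply, WithLp.ofLp_sum,
    WithLp.ofLp_add, WithLp.ofLp_smul, wave_apply, Matrix.mulVec, dotProduct, smul_eq_mul, mul_ite,
    mul_zero, Finset.sum_add_distrib, Finset.sum_ite_eq, Finset.sum_ite_eq', Finset.mem_univ,
    if_true, ← toCircle_mul_fourier, ← inv_toCircle_mul_fourier, symbol, Matrix.add_apply,
    Matrix.smul_apply]
  ring

lemma inner_wave_mulVec (M : Matrix (Fin d) (Fin d) ℂ) (k l : ℤ) (i j : Fin d) (θ : Torus) :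
    inner ℂ (wave k i θ) (Matrix.toEuclideanLin M (wave l j θ)) =
      fourier (-(k - l)) θ • M i j := by
  rw [neg_sub, sub_eq_add_neg, fourier_add, fourier_neg]
  simp [PiLp.inner_apply, Matrix.toLpLin_apply, wave_apply, Matrix.mulVec, dotProduct,
    apply_ite (starRingEnd ℂ)]
  ring

lemma fourierCoeff_symbol_inv (k : ℤ) (i j : Fin d) :
    fourierCoeff (fun θ : Torus => (symbol A (AddCircle.toCircle θ : ℂ))⁻¹ i j) k =
      invCoeff A k i j := by
  rw [fourierCoeff_eq_intervalIntegral _ _ 0, zero_add, invCoeff, Matrix.of_apply,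
    Complex.real_smul]
  congr 1
  · simp
  · refine intervalIntegral.integral_congr fun θ _ => ?_
    have h : ((AddCircle.toCircle (θ : Torus) : Circle) : ℂ) = Complex.exp (Complex.I * θ) := by
      rw [AddCircle.toCircle_apply_mk, Circle.coe_exp, mul_comm Complex.I]
      congr 3
      field_simp
    simp only [h, smul_eq_mul]
    rw [mul_comm, fourier_coe_apply]
    congr 2
    push_cast
    field_simp

lemma symbolInner_waveVec (k l : ℤ) (i j : Fin d) :
    symbolInner A (waveVec k i) (waveVec l j) = invCoeff A (k - l) i j := by
  rw [← fourierCoeff_symbol_inv, symbolInner, fourierCoeff]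
  refine integral_congr_ae ?_
  filter_upwards [coeFn_waveVec k i, coeFn_waveVec l j] with θ h1 h2
  rw [h1, h2, inner_wave_mulVec]

lemma orthonormal_waveVec : Orthonormal ℂ fun p : ℤ × Fin d => waveVec p.1 p.2 := by
  rw [orthonormal_iff_ite]
  rintro ⟨k, i⟩ ⟨l, j⟩
  -- The computation of `symbolInner_waveVec`, with the constant matrix 1 in place of Φ⁻¹.
  have h : inner ℂ (waveVec k i) (waveVec l j) =
      fourierCoeff (fun θ : Torus => (1 : Matrix (Fin d) (Fin d) ℂ) i j) (k - l) := by
    rw [L2.inner_def, fourierCoeff]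
    refine integral_congr_ae ?_
    filter_upwards [coeFn_waveVec k i, coeFn_waveVec l j] with θ h1 h2
    rw [h1, h2, ← inner_wave_mulVec]
    simp
  rw [h]
  have h2 := congrFun (fourierCoeff_fourier (T := 2 * Real.pi) 0) (k - l)
  have h3 : (fun θ : Torus => (1 : Matrix (Fin d) (Fin d) ℂ) i j) =
      (1 : Matrix (Fin d) (Fin d) ℂ) i j • ⇑(fourier (T := 2 * Real.pi) 0) := by
    ext θ; simp
  rw [h3, fourierCoeff.const_smul, h2, Matrix.one_apply]
  by_cases hk : k = l <;> by_cases hi : i = j <;> simp [hk, hi, sub_eq_zero]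

end Operators

/-! ### Real functionals on complex coordinate spaces -/

section Dual

lemma exists_eq_re_sum {ι : Type*} [Fintype ι] (L : StrongDual ℝ (ι → ℂ)) :
    ∃ c : ι → ℂ, ∀ x, L x = (∑ i, c i * x i).re := by
  classical
  -- For real a and b, Re((a - ib)(x + iy)) = ax + by.
  refine ⟨fun i => L (Pi.single i 1) - Complex.I * L (Pi.single i Complex.I), fun x => ?_⟩
  conv_lhs => rw [← Finset.univ_sum_single x]
  rw [map_sum, Complex.re_sum]
  refine Finset.sum_congr rfl fun i _ => ?_
  have h : (Pi.single i (x i) : ι → ℂ) =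
      (x i).re • (Pi.single i 1 : ι → ℂ) + (x i).im • (Pi.single i Complex.I : ι → ℂ) := by
    rw [← Pi.single_smul, ← Pi.single_smul, ← Pi.single_add]
    congr 1
    simp
  rw [h, map_add, map_smul, map_smul]
  simp [mul_comm]

lemma exists_eq_re_sum_sum {σ ι : Type*} [Fintype σ] [Fintype ι] (L : StrongDual ℝ (σ → ι → ℂ)) :
    ∃ c : σ → ι → ℂ, ∀ x, L x = (∑ k, ∑ i, c k i * x k i).re := by
  classical
  choose c hc using fun k : σ =>
    exists_eq_re_sum (L.comp (ContinuousLinearMap.single ℝ (fun _ : σ => ι → ℂ) k))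
  refine ⟨c, fun x => ?_⟩
  conv_lhs => rw [← Finset.univ_sum_single x]
  rw [map_sum, Complex.re_sum]
  exact Finset.sum_congr rfl fun k _ => hc k (x k)

end Dual

/-! ### Linear families of complex Gaussian variables -/

section Linear

variable {Ω : Type*} [MeasurableSpace Ω] {μ : Measure Ω} {V : Type*} [AddCommGroup V] [Module ℂ V]

lemma coeFn_map_sum (X : V →ₗ[ℂ] Lp ℂ 2 μ) {ι : Type*} (s : Finset ι) (c : ι → ℂ) (f : ι → V) :
    X (∑ i ∈ s, c i • f i) =ᵐ[μ] fun ω => ∑ i ∈ s, c i * X (f i) ω := by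
  have h : ∀ᵐ ω ∂μ, ∀ i : s, (c i • X (f i) : Lp ℂ 2 μ) ω = c i * X (f i) ω :=
    ae_all_iff.2 fun i => Lp.coeFn_smul (c i) (X (f i))
  rw [map_sum]
  filter_upwards [Lp.coeFn_fun_finsetSum s fun i => X (c i • f i), h] with ω h1 h2
  rw [h1]
  exact Finset.sum_congr rfl fun i hi => by rw [map_smul, h2 ⟨i, hi⟩]

lemma coeFn_map_sum_sum (X : V →ₗ[ℂ] Lp ℂ 2 μ) {σ ι : Type*} [Fintype σ] [Fintype ι]
    (c : σ → ι → ℂ) (f : σ → ι → V) :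
    X (∑ k, ∑ i, c k i • f k i) =ᵐ[μ] fun ω => ∑ k, ∑ i, c k i * X (f k i) ω := by
  have h := coeFn_map_sum X (Finset.univ : Finset (σ × ι)) (fun p => c p.1 p.2)
    (fun p => f p.1 p.2)
  simpa only [Fintype.sum_prod_type] using h

/-- The laws of the family are invariant under rotations. -/
def IsCircular (X : V →ₗ[ℂ] Lp ℂ 2 μ) : Prop :=
  ∀ (φ : ℝ) (f : V),
    μ.map (fun ω => Complex.exp (Complex.I * φ) * X f ω) = μ.map (fun ω => X f ω)

/-- The characteristic functional of a centred circular Gaussian family. -/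
def HasGaussianCharFun (X : V →ₗ[ℂ] Lp ℂ 2 μ) : Prop :=
  ∀ f, ∫ ω, Complex.exp ((X f ω).re * Complex.I) ∂μ = Complex.exp (-(‖X f‖ ^ 2 / 4 : ℝ))

lemma HasGaussianCharFun.integral_exp_sum {X : V →ₗ[ℂ] Lp ℂ 2 μ} (hX : HasGaussianCharFun X)
    {σ ι : Type*} [Fintype σ] [Fintype ι] (c : σ → ι → ℂ) (f : σ → ι → V) :
    ∫ ω, Complex.exp ((∑ k, ∑ i, c k i * X (f k i) ω).re * Complex.I) ∂μ =
      Complex.exp (-(‖X (∑ k, ∑ i, c k i • f k i)‖ ^ 2 / 4 : ℝ)) := by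
  rw [← hX]
  refine integral_congr_ae ?_
  filter_upwards [coeFn_map_sum_sum X c f] with ω h
  rw [h]

lemma measurable_coeFn (g : Lp ℂ 2 μ) : Measurable g := (Lp.stronglyMeasurable g).measurable

lemma HasGaussianCharFun.charFunDual_map {X : V →ₗ[ℂ] Lp ℂ 2 μ} (hX : HasGaussianCharFun X)
    {σ ι : Type*} [Fintype σ] [Fintype ι] (f : σ → ι → V) (L : StrongDual ℝ (σ → ι → ℂ))
    {c : σ → ι → ℂ} (hc : ∀ x, L x = (∑ k, ∑ i, c k i * x k i).re) :
    charFunDual (μ.map fun ω k i => X (f k i) ω) L =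
      Complex.exp (-(‖X (∑ k, ∑ i, c k i • f k i)‖ ^ 2 / 4 : ℝ)) := by
  have hm : Measurable fun ω k i => X (f k i) ω :=
    measurable_pi_lambda _ fun k => measurable_pi_lambda _ fun i => measurable_coeFn _
  rw [charFunDual_apply, integral_map hm.aemeasurable (by fun_prop), ← hX.integral_exp_sum]
  simp only [hc]

lemma integral_norm_sq_coeFn (g : Lp ℂ 2 μ) : ∫ ω, ‖g ω‖ ^ 2 ∂μ = ‖g‖ ^ 2 := by
  have h := L2.inner_def (𝕜 := ℂ) g g
  have h2 : (fun ω => inner ℂ (g ω) (g ω)) = fun ω => ((‖g ω‖ ^ 2 : ℝ) : ℂ) := by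
    ext ω; rw [inner_self_eq_norm_sq_to_K]; simp
  rw [h2, integral_complex_ofReal, inner_self_eq_norm_sq_to_K] at h
  exact (Complex.ofReal_injective (by simpa using h)).symm

lemma memLp_re_coeFn (g : Lp ℂ 2 μ) : MemLp (fun ω => (g ω).re) 2 μ := (Lp.memLp g).re

lemma integral_comp_circular {X : V →ₗ[ℂ] Lp ℂ 2 μ} (hc : IsCircular X)
    (φ : ℝ) (f : V) {h : ℂ → ℂ} (hh : Continuous h) :
    ∫ ω, h (Complex.exp (Complex.I * φ) * X f ω) ∂μ = ∫ ω, h (X f ω) ∂μ := by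
  have hm := measurable_coeFn (X f)
  rw [← integral_map (f := h) (hm.const_mul _).aemeasurable hh.aestronglyMeasurable, hc,
    integral_map hm.aemeasurable hh.aestronglyMeasurable]

/-- Rotation by π changes the sign of the real part but not its law. -/
lemma integral_re_coeFn_eq_zero {X : V →ₗ[ℂ] Lp ℂ 2 μ} (hc : IsCircular X)
    (f : V) : ∫ ω, (X f ω).re ∂μ = 0 := by
  have h := integral_comp_circular hc Real.pi f (h := fun z => (z.re : ℂ)) (by fun_prop)
  simp only [mul_comm Complex.I, Complex.exp_pi_mul_I, neg_one_mul, Complex.neg_re,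
    integral_complex_ofReal, Complex.ofReal_inj] at h
  rw [integral_neg] at h
  linarith

variable [IsProbabilityMeasure μ]

/-- Two families with the same characteristic functional have the same law. -/
lemma HasGaussianCharFun.map_eq {X : V →ₗ[ℂ] Lp ℂ 2 μ} (hX : HasGaussianCharFun X)
    {σ ι : Type*} [Fintype σ] [Fintype ι] (f g : σ → ι → V)
    (h : ∀ c : σ → ι → ℂ, ‖X (∑ k, ∑ i, c k i • f k i)‖ = ‖X (∑ k, ∑ i, c k i • g k i)‖) :
    μ.map (fun ω k i => X (f k i) ω) = μ.map (fun ω k i => X (g k i) ω) := by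
  have hm : ∀ f : σ → ι → V, Measurable fun ω k i => X (f k i) ω := fun f =>
    measurable_pi_lambda _ fun k => measurable_pi_lambda _ fun i => measurable_coeFn _
  have := Measure.isProbabilityMeasure_map (μ := μ) (hm f).aemeasurable
  have := Measure.isProbabilityMeasure_map (μ := μ) (hm g).aemeasurable
  refine Measure.ext_of_charFunDual (funext fun L => ?_)
  obtain ⟨c, hc⟩ := exists_eq_re_sum_sum L
  rw [hX.charFunDual_map f L hc, hX.charFunDual_map g L hc, h]

lemma HasGaussianCharFun.map_re {X : V →ₗ[ℂ] Lp ℂ 2 μ} (hX : HasGaussianCharFun X) (f : V) :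
    μ.map (fun ω => (X f ω).re) = gaussianReal 0 (‖X f‖₊ ^ 2 / 2) := by
  have hm : Measurable fun ω => (X f ω).re := Complex.measurable_re.comp (measurable_coeFn _)
  have := Measure.isProbabilityMeasure_map (μ := μ) hm.aemeasurable
  refine Measure.ext_of_charFun (funext fun t => ?_)
  rw [charFun_apply_real, integral_map hm.aemeasurable (by fun_prop), charFun_gaussianReal]
  -- The characteristic function at t comes from the characteristic functional at t f, by linearity
  -- of X.
  have h : ∀ᵐ ω ∂μ, Complex.exp (t * ((X f ω).re : ℝ) * Complex.I) =
      Complex.exp ((X ((t : ℂ) • f) ω).re * Complex.I) := by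
    rw [map_smul]
    filter_upwards [Lp.coeFn_smul (t : ℂ) (X f)] with ω hω
    rw [hω]
    simp
  rw [integral_congr_ae h, hX, map_smul, norm_smul]
  congr 1
  push_cast
  simp [mul_pow, ← Complex.ofReal_pow]
  ring

/-- By linearity, every real functional of finitely many X(f) is almost surely the real part of a
single X(g), which is a real Gaussian variable. -/
lemma HasGaussianCharFun.isGaussianProcess {X : V →ₗ[ℂ] Lp ℂ 2 μ} (hX : HasGaussianCharFun X) :
    IsGaussianProcess (fun f ω => X f ω) μ where
  hasGaussianLaw I := by
    have hm : Measurable fun ω => I.restrict (fun f => X f ω) :=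
      measurable_pi_lambda _ fun f => measurable_coeFn _
    refine ⟨isGaussian_of_map_eq_gaussianReal fun L => ?_⟩
    obtain ⟨c, hc⟩ := exists_eq_re_sum L
    refine ⟨0, ‖X (∑ i, c i • (i : V))‖₊ ^ 2 / 2, ?_⟩
    rw [Measure.map_map L.continuous.measurable hm, ← hX.map_re]
    refine Measure.map_congr ?_
    filter_upwards [coeFn_map_sum X Finset.univ c (fun i => (i : V))] with ω h
    rw [h, Function.comp_apply, hc]
    rfl

/-- The characteristic functional depends on f only through ‖X f‖, which a unimodular factor leaves
unchanged. -/
lemma HasGaussianCharFun.circular {X : V →ₗ[ℂ] Lp ℂ 2 μ} (hX : HasGaussianCharFun X) :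
    IsCircular X := by
  intro φ f
  set e := Complex.exp (Complex.I * φ) with he
  have hn : ‖e‖ = 1 := by rw [he, mul_comm, Complex.norm_exp_ofReal_mul_I]
  have h := hX.map_eq (σ := Unit) (ι := Unit) (fun _ _ => e • f) (fun _ _ => f) fun c => by
    simp [norm_smul, hn, smul_smul]
  have h2 := congrArg (Measure.map fun x : Unit → Unit → ℂ => x () ()) h
  have hm : ∀ f : V, Measurable fun ω (_ _ : Unit) => X f ω := fun f =>
    measurable_pi_lambda _ fun k => measurable_pi_lambda _ fun i => measurable_coeFn _
  rw [Measure.map_map (by fun_prop) (hm _), Measure.map_map (by fun_prop) (hm _)] at h2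
  refine Eq.trans (Measure.map_congr ?_) h2
  filter_upwards [Lp.coeFn_smul e (X f)] with ω h
  simp only [Function.comp_apply, map_smul, h]
  rfl

/-! Conversely, a circular Gaussian family has this characteristic functional. -/

variable {X : V →ₗ[ℂ] Lp ℂ 2 μ}

/-- Rotation by π/2 turns the real part into minus the imaginary part, so each carries half of the
second moment ‖X f‖². This is the origin of the factor 1/4 in `HasGaussianCharFun`. -/
lemma variance_re_coeFn (hc : IsCircular X) (f : V) :
    Var[fun ω => (X f ω).re; μ] = ‖X f‖ ^ 2 / 2 := by
  rw [variance_eq_sub (memLp_re_coeFn _), integral_re_coeFn_eq_zero hc, ← integral_norm_sq_coeFn]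
  have h := integral_comp_circular hc (Real.pi / 2) f (h := fun z => ((z.re ^ 2 : ℝ) : ℂ))
    (by fun_prop)
  have h1 : Complex.exp (Complex.I * ((Real.pi / 2 : ℝ) : ℂ)) = Complex.I := by
    rw [mul_comm]; push_cast; exact Complex.exp_pi_div_two_mul_I
  rw [h1] at h
  simp only [Complex.I_mul_re, integral_complex_ofReal, Complex.ofReal_inj] at h
  have hre := (memLp_re_coeFn (X f)).integrable_sq
  have him : Integrable (fun ω => (-(X f ω).im) ^ 2) μ := (Lp.memLp (X f)).im.neg.integrable_sq
  have h3 : ∫ ω, ‖X f ω‖ ^ 2 ∂μ = ∫ ω, (-(X f ω).im) ^ 2 ∂μ + ∫ ω, (X f ω).re ^ 2 ∂μ := by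
    rw [← integral_add him hre]
    refine integral_congr_ae (.of_forall fun ω => ?_)
    simp only [← Complex.normSq_eq_norm_sq, Complex.normSq_apply]
    ring
  rw [h3, h]
  simp

/-- Polarization of `variance_re_coeFn`. -/
lemma covariance_re_coeFn (hc : IsCircular X) (f g : V) :
    cov[fun ω => (X f ω).re, fun ω => (X g ω).re; μ] = (inner ℂ (X f) (X g)).re / 2 := by
  have h := variance_add (memLp_re_coeFn (X f)) (memLp_re_coeFn (X g))
  have h2 : Var[fun ω => (X (f + g) ω).re; μ] =
      Var[(fun ω => (X f ω).re) + fun ω => (X g ω).re; μ] := by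
    refine variance_congr ?_
    rw [map_add]
    filter_upwards [Lp.coeFn_add (X f) (X g)] with ω hω
    rw [hω]; simp
  rw [← h2, variance_re_coeFn hc, variance_re_coeFn hc, variance_re_coeFn hc, map_add] at h
  have h3 := norm_add_sq (𝕜 := ℂ) (X f) (X g)
  rw [RCLike.re_eq_complex_re] at h3
  linarith

lemma hasGaussianCharFun (hg : IsGaussianProcess (fun f ω => X f ω) μ)
    (hc : IsCircular X) :
    HasGaussianCharFun X := by
  intro f
  have h := (hg.hasGaussianLaw_eval f).charFunDual_map_eq Complex.reCLM
  rw [charFunDual_apply, integral_map (measurable_coeFn _).aemeasurable (by fun_prop)] at h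
  have h1 := integral_re_coeFn_eq_zero hc f
  have h2 := variance_re_coeFn hc f
  simp only [Function.comp_def, Complex.reCLM_apply] at h
  rw [h, h1, h2]
  congr 1
  push_cast
  ring

end Linear

/-! ### Existence of complex Gaussian Hilbert spaces -/

section Existence

/-- A family of independent standard complex Gaussian variables. -/
def gaussianSpace (ι : Type*) : Measure (ι → ℂ) := Measure.infinitePi fun _ : ι => stdGaussian ℂ

instance (ι : Type*) : IsProbabilityMeasure (gaussianSpace ι) := by
  unfold gaussianSpace; infer_instance

variable {ι : Type*}

lemma measurePreserving_eval_gaussianSpace (i : ι) :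
    MeasurePreserving (fun ω : ι → ℂ => ω i) (gaussianSpace ι) (stdGaussian ℂ) :=
  ⟨by fun_prop, Measure.infinitePi_map_eval _ i⟩

lemma memLp_eval_gaussianSpace (i : ι) : MemLp (fun ω : ι → ℂ => ω i) 2 (gaussianSpace ι) :=
  (IsGaussian.memLp_two_id (μ := stdGaussian ℂ)).comp_measurePreserving
    (measurePreserving_eval_gaussianSpace i)

lemma iIndepFun_eval_gaussianSpace :
    iIndepFun (fun (i : ι) (ω : ι → ℂ) => ω i) (gaussianSpace ι) :=
  iIndepFun_infinitePi (X := fun _ z => z) fun _ => measurable_id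

lemma integral_eval_gaussianSpace (i : ι) : ∫ ω, ω i ∂gaussianSpace ι = 0 := by
  have h := (measurePreserving_eval_gaussianSpace i).map_eq
  rw [← integral_id_stdGaussian (E := ℂ), ← h,
    integral_map (measurable_pi_apply i).aemeasurable (by fun_prop)]

/-- As a real space ℂ has the orthonormal basis 1, i, and each coordinate has variance 1. The factor
1/√2 in `gaussianCoord` compensates for the total 2. -/
lemma integral_norm_sq_stdGaussian : ∫ z, ‖z‖ ^ 2 ∂stdGaussian ℂ = 2 := by
  have hv : ∀ t : ℂ, ∫ z, (inner ℝ t z) ^ 2 ∂stdGaussian ℂ = ‖t‖ ^ 2 := fun t => by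
    have h1 : Var[fun z => inner ℝ t z; stdGaussian ℂ] = ‖t‖ ^ 2 := by
      rw [← covarianceBilin_self IsGaussian.memLp_two_id, covarianceBilin_stdGaussian]
      exact real_inner_self_eq_norm_sq t
    have hL : MemLp (fun z : ℂ => inner ℝ t z) 2 (stdGaussian ℂ) :=
      IsGaussian.memLp_dual _ (innerSL ℝ t) 2 (by simp)
    have h0 : ∫ z, inner ℝ t z ∂stdGaussian ℂ = 0 := integral_strongDual_stdGaussian (innerSL ℝ t)
    rw [variance_eq_sub hL, h0] at h1
    simpa using h1
  have hi : ∀ t : ℂ, Integrable (fun z => (inner ℝ t z) ^ 2) (stdGaussian ℂ) := fun t =>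
    (IsGaussian.memLp_dual (stdGaussian ℂ) (innerSL ℝ t) 2 (by simp)).integrable_sq
  have h : ∀ z : ℂ, ‖z‖ ^ 2 = (inner ℝ 1 z) ^ 2 + (inner ℝ Complex.I z) ^ 2 := fun z => by
    rw [← Complex.normSq_eq_norm_sq, Complex.normSq_apply, Complex.inner, Complex.inner]
    simp
    ring
  simp_rw [h]
  rw [integral_add (hi _) (hi _), hv, hv]
  norm_num

/-- The coordinates of `gaussianSpace ι`, normalised. -/
def gaussianCoord (i : ι) : Lp ℂ 2 (gaussianSpace ι) :=
  (((Real.sqrt 2)⁻¹ : ℝ) : ℂ) • (memLp_eval_gaussianSpace i).toLp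

lemma coeFn_gaussianCoord (i : ι) :
    gaussianCoord i =ᵐ[gaussianSpace ι] fun ω => (((Real.sqrt 2)⁻¹ : ℝ) : ℂ) * ω i := by
  filter_upwards [Lp.coeFn_smul (((Real.sqrt 2)⁻¹ : ℝ) : ℂ) (memLp_eval_gaussianSpace i).toLp,
    (memLp_eval_gaussianSpace i).coeFn_toLp] with ω h1 h2
  rw [gaussianCoord, h1, Pi.smul_apply, h2, smul_eq_mul]

lemma orthonormal_gaussianCoord : Orthonormal ℂ (gaussianCoord (ι := ι)) := by
  have h : ∀ i j : ι, inner ℂ (gaussianCoord i) (gaussianCoord j) =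
      (1 / 2 : ℂ) * ∫ ω, star (ω i) * ω j ∂gaussianSpace ι := fun i j => by
    rw [L2.inner_def, ← integral_const_mul]
    refine integral_congr_ae ?_
    filter_upwards [coeFn_gaussianCoord i, coeFn_gaussianCoord j] with ω h1 h2
    rw [h1, h2]
    have : ((Real.sqrt 2 : ℝ) : ℂ) ^ 2 = 2 := by
      rw [← Complex.ofReal_pow, Real.sq_sqrt (by norm_num)]; norm_num
    have h2 : (((Real.sqrt 2)⁻¹ : ℝ) : ℂ) * (((Real.sqrt 2)⁻¹ : ℝ) : ℂ) = 1 / 2 := by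
      rw [Complex.ofReal_inv, ← mul_inv, ← sq, this, one_div]
    rw [RCLike.inner_apply, map_mul, Complex.conj_ofReal, starRingEnd_apply, ← h2]
    ring
  classical
  rw [orthonormal_iff_ite]
  intro i j
  rw [h]
  split_ifs with hij
  · subst hij
    have h1 : ∀ ω : ι → ℂ, star (ω i) * ω i = ((‖ω i‖ ^ 2 : ℝ) : ℂ) := fun ω => by
      rw [← Complex.normSq_eq_norm_sq, Complex.normSq_eq_conj_mul_self]; rfl
    simp_rw [h1]
    rw [integral_complex_ofReal]
    have h2 := (measurePreserving_eval_gaussianSpace i).map_eq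
    have h3 := integral_norm_sq_stdGaussian
    rw [← h2, integral_map (measurable_pi_apply i).aemeasurable (by fun_prop)] at h3
    rw [h3]
    norm_num
  · have hind : IndepFun (fun ω : ι → ℂ => star (ω i)) (fun ω => ω j) (gaussianSpace ι) :=
      (iIndepFun_eval_gaussianSpace.indepFun hij).comp (φ := fun z => star z) (ψ := id)
        (by fun_prop) measurable_id
    rw [hind.integral_fun_mul_eq_mul_integral
      (continuous_star.measurable.comp (measurable_pi_apply i)).aestronglyMeasurable
      (measurable_pi_apply j).aestronglyMeasurable,
      integral_eval_gaussianSpace]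
    simp

lemma integral_exp_re_sum_gaussianSpace (s : Finset ι) (c : ι → ℂ) :
    ∫ ω, Complex.exp ((∑ i ∈ s, c i * ω i).re * Complex.I) ∂gaussianSpace ι =
      ∏ i ∈ s, Complex.exp (-(‖c i‖ ^ 2 / 2 : ℝ)) := by
  have h1 : ∀ ω : ι → ℂ, Complex.exp ((∑ i ∈ s, c i * ω i).re * Complex.I) =
      ∏ i : s, Complex.exp ((c i * ω i).re * Complex.I) := fun ω => by
    rw [Finset.prod_coe_sort s (fun i => Complex.exp ((c i * ω i).re * Complex.I)),
      ← Complex.exp_sum, ← Finset.sum_mul, Complex.re_sum]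
    push_cast
    rfl
  simp_rw [h1]
  have hind : iIndepFun (fun (i : s) (ω : ι → ℂ) => Complex.exp ((c i * ω i).re * Complex.I))
      (gaussianSpace ι) :=
    (iIndepFun_eval_gaussianSpace.precomp Subtype.val_injective).comp
      (fun (i : s) z => Complex.exp ((c i * z).re * Complex.I)) fun i => by fun_prop
  rw [hind.integral_fun_prod_eq_prod_integral fun i => by fun_prop,
    ← Finset.prod_coe_sort s]
  refine Finset.prod_congr rfl fun i _ => ?_
  have h2 := (measurePreserving_eval_gaussianSpace (i : ι)).map_eq
  have h3 := charFun_stdGaussian (star (c i) : ℂ)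
  rw [charFun_apply, ← h2,
    integral_map (measurable_pi_apply (i : ι)).aemeasurable (by fun_prop)] at h3
  simp only [Complex.inner] at h3
  rw [norm_star] at h3
  convert h3 using 1
  · refine integral_congr_ae (.of_forall fun ω => ?_)
    simp [mul_comm]
  · push_cast; ring_nf

/-- Since |e^{ia} - e^{ib}| ≤ |a - b|, the characteristic functional is continuous on L². This
allows the passage from the span of a Hilbert basis to its closure. -/
lemma norm_integral_exp_sub_le {Ω : Type*} [MeasurableSpace Ω] {μ : Measure Ω}
    [IsProbabilityMeasure μ] (u v : Lp ℂ 2 μ) :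
    ‖(∫ ω, Complex.exp ((u ω).re * Complex.I) ∂μ) - ∫ ω, Complex.exp ((v ω).re * Complex.I) ∂μ‖ ≤
      ‖u - v‖ := by
  have hi : ∀ u : Lp ℂ 2 μ, Integrable (fun ω => Complex.exp ((u ω).re * Complex.I)) μ := fun u => by
    refine Integrable.of_bound (C := 1) ?_ (.of_forall fun ω => ?_)
    · have := measurable_coeFn u
      exact Measurable.aestronglyMeasurable (by fun_prop)
    · rw [Complex.norm_exp_ofReal_mul_I]
  rw [← integral_sub (hi u) (hi v)]
  refine (norm_integral_le_integral_norm _).trans ?_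
  have h2 : Integrable (fun ω => ‖(u - v : Lp ℂ 2 μ) ω‖) μ :=
    ((Lp.memLp (u - v)).integrable one_le_two).norm
  refine (integral_mono_ae ((hi u).sub (hi v)).norm h2 ?_).trans ?_
  · filter_upwards [Lp.coeFn_sub u v] with ω hω
    rw [hω]
    have h : Complex.exp ((u ω).re * Complex.I) - Complex.exp ((v ω).re * Complex.I) =
        Complex.exp ((v ω).re * Complex.I) *
          (Complex.exp (Complex.I * ((u ω).re - (v ω).re : ℝ)) - 1) := by
      rw [mul_sub, ← Complex.exp_add, mul_one]
      congr 2
      push_cast; ring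
    rw [Pi.sub_apply, Pi.sub_apply, h, norm_mul, Complex.norm_exp_ofReal_mul_I, one_mul]
    refine Real.norm_exp_I_mul_ofReal_sub_one_le.trans ?_
    rw [Real.norm_eq_abs, ← Complex.sub_re]
    exact Complex.abs_re_le_norm _
  -- The L¹ norm is at most the L² norm because the variance of |u - v| is nonnegative.
  · have h3 : (∫ ω, ‖(u - v : Lp ℂ 2 μ) ω‖ ∂μ) ^ 2 ≤ ‖u - v‖ ^ 2 := by
      rw [← integral_norm_sq_coeFn (u - v)]
      have := variance_nonneg (fun ω => ‖(u - v : Lp ℂ 2 μ) ω‖) μ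
      rw [variance_eq_sub (Lp.memLp (u - v)).norm] at this
      simpa using this
    exact (abs_le_of_sq_le_sq' h3 (norm_nonneg _)).2

/-- Every complex Hilbert space has an isometric embedding into an `L²` space whose image is a
circular Gaussian family. -/
lemma exists_gaussian_linearIsometry (H : Type*) [NormedAddCommGroup H] [InnerProductSpace ℂ H]
    [CompleteSpace H] :
    ∃ (w : Set H) (J : H →ₗᵢ[ℂ] Lp ℂ 2 (gaussianSpace w)), HasGaussianCharFun J.toLinearMap := by
  obtain ⟨w, b, hb⟩ := exists_hilbertBasis ℂ H
  classical
  let J : H →ₗᵢ[ℂ] Lp ℂ 2 (gaussianSpace w) :=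
    (orthonormal_gaussianCoord (ι := w)).orthogonalFamily.linearIsometry.comp
      b.repr.toLinearIsometry
  have hJ : ∀ i, J (b i) = gaussianCoord i := fun i => by
    simp [J, b.repr_self]
  refine ⟨w, J, ?_⟩
  -- The formula is checked on finite combinations of basis vectors, where independence applies;
  -- they are dense, and the set on which it holds is closed.
  have hclosed : IsClosed {f : H | ∫ ω, Complex.exp ((J f ω).re * Complex.I) ∂gaussianSpace w =
      Complex.exp (-(‖J f‖ ^ 2 / 4 : ℝ))} := by
    refine isClosed_eq ?_ (by fun_prop)
    have : LipschitzWith 1 fun u : Lp ℂ 2 (gaussianSpace w) =>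
        ∫ ω, Complex.exp ((u ω).re * Complex.I) ∂gaussianSpace w :=
      LipschitzWith.of_dist_le_mul fun u v => by
        rw [dist_eq_norm, dist_eq_norm]; simpa using norm_integral_exp_sub_le u v
    exact this.continuous.comp J.continuous
  have hspan : ∀ f ∈ Submodule.span ℂ (Set.range b),
      ∫ ω, Complex.exp ((J f ω).re * Complex.I) ∂gaussianSpace w =
        Complex.exp (-(‖J f‖ ^ 2 / 4 : ℝ)) := by
    intro f hf
    obtain ⟨c, rfl⟩ := (Finsupp.mem_span_range_iff_exists_finsupp).1 hf
    have h1 := coeFn_map_sum J.toLinearMap c.support c b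
    have h2 : ∀ᵐ ω ∂gaussianSpace w, ∀ i : c.support, gaussianCoord (i : w) ω =
        (((Real.sqrt 2)⁻¹ : ℝ) : ℂ) * ω i := ae_all_iff.2 fun i => coeFn_gaussianCoord (i : w)
    have h3 := integral_exp_re_sum_gaussianSpace c.support
      (fun i => (((Real.sqrt 2)⁻¹ : ℝ) : ℂ) * c i)
    have h4 : ‖J (c.sum fun i a => a • b i)‖ ^ 2 = ∑ i ∈ c.support, ‖c i‖ ^ 2 := by
      rw [J.norm_map, Finsupp.sum]
      rw [← Complex.ofReal_inj, Complex.ofReal_pow]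
      rw [← RCLike.ofReal_eq_complex_ofReal, ← inner_self_eq_norm_sq_to_K,
        b.orthonormal.inner_sum]
      push_cast
      refine Finset.sum_congr rfl fun i _ => ?_
      rw [← Complex.normSq_eq_conj_mul_self, Complex.normSq_eq_norm_sq]
      simp
    rw [h4]
    have h5 : ∏ i ∈ c.support, Complex.exp (-(‖(((Real.sqrt 2)⁻¹ : ℝ) : ℂ) * c i‖ ^ 2 / 2 : ℝ)) =
        Complex.exp (-((∑ i ∈ c.support, ‖c i‖ ^ 2) / 4 : ℝ)) := by
      rw [← Complex.exp_sum]
      congr 1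
      rw [Finset.sum_div, Complex.ofReal_sum, ← Finset.sum_neg_distrib]
      refine Finset.sum_congr rfl fun i _ => ?_
      have : (Real.sqrt 2) ^ 2 = 2 := Real.sq_sqrt (by norm_num)
      rw [norm_mul, Complex.norm_real, norm_inv, Real.norm_of_nonneg (Real.sqrt_nonneg _),
        mul_pow, inv_pow, this]
      push_cast
      ring
    rw [← h5, ← h3]
    refine integral_congr_ae ?_
    filter_upwards [h1, h2] with ω h1 h2
    have h6 : J (c.sum fun i a => a • b i) ω = ∑ i ∈ c.support, c i * J (b i) ω := h1
    rw [h6]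
    congr 4
    refine Finset.sum_congr rfl fun i hi => ?_
    rw [hJ, h2 ⟨i, hi⟩]
    ring
  intro f
  have hd : f ∈ closure (Submodule.span ℂ (Set.range b) : Set H) := by
    rw [← Submodule.topologicalClosure_coe, b.dense_span]
    trivial
  exact closure_minimal (fun f hf => hspan f hf) hclosed hd

lemma exists_isGaussianIsometry {d : ℕ} {A : Matrix (Fin d ⊕ Fin d) (Fin d ⊕ Fin d) ℂ}
    (hA : A.PosDef) :
    ∃ (Ω : Type) (_ : MeasurableSpace Ω) (μ : Measure Ω) (_ : IsProbabilityMeasure μ)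
      (X : SymbolSpace d →ₗ[ℂ] Lp ℂ 2 μ), IsGaussianIsometry A μ X := by
  obtain ⟨w, J, hJ⟩ := exists_gaussian_linearIsometry (SymbolSpace d)
  obtain ⟨S, hS⟩ := exists_inner_eq_symbolInner hA
  have hX : HasGaussianCharFun (J.toLinearMap ∘ₗ S.toLinearMap) := fun f => hJ (S f)
  refine ⟨w → ℂ, inferInstance, gaussianSpace w, inferInstance, J.toLinearMap ∘ₗ S.toLinearMap,
    fun f => ?_, hX.isGaussianProcess, hX.circular⟩
  rw [← hS, inner_self_eq_norm_sq_to_K]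
  simp

end Existence

/-! ### Gaussian densities -/

section Density

variable {E W : Type*} [NormedAddCommGroup E] [NormedSpace ℝ E]
  [MeasurableSpace E] [BorelSpace E] (ν : Measure E)
  [NormedAddCommGroup W] [InnerProductSpace ℝ W] [FiniteDimensional ℝ W] [MeasurableSpace W]
  [BorelSpace W] (e : E ≃L[ℝ] W)

lemma integrable_gaussianWeight :
    Integrable fun v : W => Real.exp (-(1 / 2 : ℝ) * ‖v‖ ^ 2) := by
  have h := GaussianFourier.integrable_cexp_neg_mul_sq_norm_add (V := W) (b := 1 / 2)
    (by norm_num) 0 0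
  have h2 := h.norm
  refine h2.congr (.of_forall fun v => ?_)
  have : -(1 / 2 : ℂ) * (‖v‖ : ℂ) ^ 2 + 0 * ((inner ℝ (0 : W) v : ℝ) : ℂ) =
      ((-(1 / 2 : ℝ) * ‖v‖ ^ 2 : ℝ) : ℂ) := by push_cast; ring
  simp only [this, Complex.norm_exp_ofReal]

lemma integral_gaussianWeight_pos :
    0 < ∫ v : W, Real.exp (-(1 / 2 : ℝ) * ‖v‖ ^ 2) := by
  rw [GaussianFourier.integral_rexp_neg_mul_sq_norm (by norm_num)]
  positivity

lemma lintegral_gaussianWeight (c : ENNReal) (hc : ν.map e = c • (volume : Measure W)) :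
    ∫⁻ x, ENNReal.ofReal (Real.exp (-(1 / 2 : ℝ) * ‖e x‖ ^ 2)) ∂ν =
      c * ENNReal.ofReal (∫ v : W, Real.exp (-(1 / 2 : ℝ) * ‖v‖ ^ 2)) := by
  have h := lintegral_map (μ := ν) (g := e)
    (f := fun v : W => ENNReal.ofReal (Real.exp (-(1 / 2 : ℝ) * ‖v‖ ^ 2)))
    (by fun_prop) e.continuous.measurable
  rw [← h, hc, lintegral_smul_measure, smul_eq_mul,
    ofReal_integral_eq_lintegral_ofReal integrable_gaussianWeight
      (.of_forall fun v => (Real.exp_pos _).le)]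

variable [ν.IsAddHaarMeasure]

/-- Haar measure is unique up to a factor. The factor, essentially the Jacobian of `e`, cancels in
the normalised density and is never computed. -/
lemma exists_map_eq_smul :
    ∃ c : ENNReal, c ≠ 0 ∧ c ≠ ⊤ ∧ ν.map e = c • (volume : Measure W) := by
  have := e.isAddHaarMeasure_map ν
  refine ⟨Measure.addHaarScalarFactor (ν.map e) volume, ?_, by simp,
    Measure.isAddLeftInvariant_eq_smul (ν.map e) volume⟩
  simpa using (Measure.addHaarScalarFactor_pos_of_isAddHaarMeasure (ν.map e) volume).ne'

lemma isProbabilityMeasure_gaussianWeight :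
    IsProbabilityMeasure
      ((∫⁻ x, ENNReal.ofReal (Real.exp (-(1 / 2 : ℝ) * ‖e x‖ ^ 2)) ∂ν)⁻¹ •
        ν.withDensity fun x => ENNReal.ofReal (Real.exp (-(1 / 2 : ℝ) * ‖e x‖ ^ 2))) := by
  obtain ⟨c, hc0, hct, hc⟩ := exists_map_eq_smul ν e
  refine ⟨?_⟩
  rw [Measure.smul_apply, withDensity_apply _ MeasurableSet.univ, Measure.restrict_univ,
    smul_eq_mul, lintegral_gaussianWeight ν e c hc]
  refine ENNReal.inv_mul_cancel (mul_ne_zero hc0 ?_) (ENNReal.mul_ne_top hct ENNReal.ofReal_ne_top)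
  simpa using integral_gaussianWeight_pos (W := W)

lemma integral_exp_gaussianWeight (w : W) :
    ∫ x, Complex.exp (Complex.I * (inner ℝ w (e x) : ℝ))
      ∂((∫⁻ x, ENNReal.ofReal (Real.exp (-(1 / 2 : ℝ) * ‖e x‖ ^ 2)) ∂ν)⁻¹ •
        ν.withDensity fun x => ENNReal.ofReal (Real.exp (-(1 / 2 : ℝ) * ‖e x‖ ^ 2))) =
      Complex.exp (-(‖w‖ ^ 2 / 2 : ℝ)) := by
  obtain ⟨c, hc0, hct, hc⟩ := exists_map_eq_smul ν e
  have hpos := integral_gaussianWeight_pos (W := W)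
  rw [integral_smul_measure, integral_withDensity_eq_integral_toReal_smul (by fun_prop)
    (.of_forall fun x => ENNReal.ofReal_lt_top), lintegral_gaussianWeight ν e c hc]
  have h1 : ∀ x, (ENNReal.ofReal (Real.exp (-(1 / 2 : ℝ) * ‖e x‖ ^ 2))).toReal •
      Complex.exp (Complex.I * (inner ℝ w (e x) : ℝ)) =
      (fun v : W => Complex.exp (-(1 / 2 : ℂ) * (‖v‖ : ℂ) ^ 2 + Complex.I * (inner ℝ w v : ℝ)))
        (e x) := fun x => by
    rw [ENNReal.toReal_ofReal (Real.exp_pos _).le, Complex.real_smul, Complex.ofReal_exp,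
      ← Complex.exp_add]
    push_cast
    rfl
  simp_rw [h1]
  have he : MeasurableEmbedding e := e.toHomeomorph.measurableEmbedding
  rw [← he.integral_map
    (g := fun v : W => Complex.exp (-(1 / 2 : ℂ) * (‖v‖ : ℂ) ^ 2 + Complex.I * (inner ℝ w v : ℝ)))]
  rw [hc, integral_smul_measure]
  -- The Gaussian integral without linear term is the normalising constant; the one with linear term
  -- i⟨w, v⟩ is the same constant times the required exponential.
  have h3 := GaussianFourier.integral_cexp_neg_mul_sq_norm_add (V := W) (b := 1 / 2)
    (by norm_num) 0 0
  have h4 := GaussianFourier.integral_cexp_neg_mul_sq_norm_add (V := W) (b := 1 / 2)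
    (by norm_num) Complex.I w
  have h5 : ((∫ v : W, Real.exp (-(1 / 2 : ℝ) * ‖v‖ ^ 2) : ℝ) : ℂ) =
      (Real.pi / (1 / 2) : ℂ) ^ (Module.finrank ℝ W / 2 : ℂ) := by
    rw [← integral_complex_ofReal]
    simpa using h3
  rw [h4, ← h5]
  have hcr : (c.toReal : ℂ) ≠ 0 := by
    exact_mod_cast (ENNReal.toReal_pos hc0 hct).ne'
  have hzr : ((∫ v : W, Real.exp (-(1 / 2 : ℝ) * ‖v‖ ^ 2) : ℝ) : ℂ) ≠ 0 := by
    exact_mod_cast hpos.ne'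
  rw [ENNReal.toReal_inv, ENNReal.toReal_mul, ENNReal.toReal_ofReal hpos.le, Complex.real_smul,
    Complex.real_smul]
  clear h5 h3 h1
  generalize (∫ v : W, Real.exp (-(1 / 2 : ℝ) * ‖v‖ ^ 2)) = Z at hzr ⊢
  push_cast
  have h6 : Complex.I ^ 2 * (‖w‖ : ℂ) ^ 2 / (4 * (1 / 2)) = -((‖w‖ : ℂ) ^ 2 / 2) := by
    rw [Complex.I_sq]; ring
  rw [h6]
  field_simp

end Density

/-! ### The periodic precision matrix -/

section Periodic

variable {d : ℕ} {A : Matrix (Fin d ⊕ Fin d) (Fin d ⊕ Fin d) ℂ} {P : ℕ} [NeZero P]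

/-- The three kinds of blocks are summed separately, so the formula persists for P = 1 and P = 2,
where neighbouring positions coincide. -/
lemma periodicMatrix_mulVec (x : ZMod P × Fin d → ℂ) (k : ZMod P) (i : Fin d) :
    (periodicMatrix A P).mulVec x (k, i) =
      ((A.toBlocks₁₁ + A.toBlocks₂₂).mulVec fun j => x (k, j)) i +
      (A.toBlocks₁₂.mulVec fun j => x (k + 1, j)) i +
      (A.toBlocks₂₁.mulVec fun j => x (k - 1, j)) i := by
  have h : ∀ l : ZMod P, k = l + 1 ↔ l = k - 1 := fun l => by
    rw [eq_sub_iff_add_eq, eq_comm]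
  simp only [Matrix.mulVec, dotProduct, periodicMatrix, Matrix.of_apply, Fintype.sum_prod_type,
    add_mul, ite_mul, zero_mul, Finset.sum_add_distrib, Matrix.add_apply, h]
  simp only [Finset.sum_ite_irrel, Finset.sum_const_zero, Finset.sum_ite_eq',
    Finset.mem_univ, if_true, Finset.sum_add_distrib]

lemma star_dotProduct_periodicMatrix_mulVec (x : ZMod P × Fin d → ℂ) :
    star x ⬝ᵥ (periodicMatrix A P).mulVec x =
      ∑ k : ZMod P, star (Sum.elim (fun i => x (k, i)) fun i => x (k + 1, i)) ⬝ᵥ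
        A.mulVec (Sum.elim (fun i => x (k, i)) fun i => x (k + 1, i)) := by
  have hstar : ∀ v w : Fin d → ℂ, star (Sum.elim v w) = Sum.elim (star v) (star w) := fun v w => by
    ext (i | i) <;> rfl
  have h1 : star x ⬝ᵥ (periodicMatrix A P).mulVec x = ∑ k : ZMod P, (star fun i => x (k, i)) ⬝ᵥ
      ((A.toBlocks₁₁ + A.toBlocks₂₂).mulVec (fun j => x (k, j)) +
        A.toBlocks₁₂.mulVec (fun j => x (k + 1, j)) +
        A.toBlocks₂₁.mulVec (fun j => x (k - 1, j))) := by
    simp only [dotProduct, Fintype.sum_prod_type, periodicMatrix_mulVec, Pi.add_apply]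
    rfl
  rw [h1]
  conv_rhs => rw [← A.fromBlocks_toBlocks]
  simp only [hstar, Matrix.fromBlocks_mulVec, sumElim_dotProduct_sumElim, Matrix.add_mulVec,
    dotProduct_add, Finset.sum_add_distrib, Sum.elim_comp_inl, Sum.elim_comp_inr]
  -- On the edge from k to k + 1 the lower blocks of A sit at the vertex k + 1, whereas Q indexes
  -- them by their own vertex; a cyclic shift matches the two sums.
  have h2 := Equiv.sum_comp (Equiv.addRight (1 : ZMod P)) fun k =>
    (star fun i => x (k, i)) ⬝ᵥ A.toBlocks₂₂.mulVec fun j => x (k, j)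
  have h3 := Equiv.sum_comp (Equiv.addRight (1 : ZMod P)) fun k =>
    (star fun i => x (k, i)) ⬝ᵥ A.toBlocks₂₁.mulVec fun j => x (k - 1, j)
  simp only [Equiv.coe_addRight, add_sub_cancel_right] at h2 h3
  rw [h2, h3]
  ring

lemma posDef_periodicMatrix (hA : A.PosDef) : (periodicMatrix A P).PosDef := by
  refine Matrix.PosDef.of_dotProduct_mulVec_pos ?_ fun x hx => ?_
  · have h := hA.isHermitian
    rw [← A.fromBlocks_toBlocks, Matrix.isHermitian_fromBlocks_iff] at h
    obtain ⟨h1, h2, h3, h4⟩ := h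
    ext ⟨k, i⟩ ⟨l, j⟩
    have e1 := fun i j => h1.apply i j
    have e4 := fun i j => h4.apply i j
    have e2 : ∀ i j, star (A.toBlocks₁₂ j i) = A.toBlocks₂₁ i j := fun i j => by
      rw [← h2]; rfl
    have e3 : ∀ i j, star (A.toBlocks₂₁ j i) = A.toBlocks₁₂ i j := fun i j => by
      rw [← h3]; rfl
    simp only [Matrix.conjTranspose_apply, periodicMatrix, Matrix.of_apply, star_add,
      apply_ite star, e1, e2, e3, e4, star_zero, eq_comm (a := k) (b := l)]
    ring
  · rw [star_dotProduct_periodicMatrix_mulVec]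
    obtain ⟨⟨k, i⟩, hki⟩ := Function.ne_iff.1 hx
    -- All edge terms are nonnegative, and the edge starting at a vertex where x does not vanish
    -- contributes strictly.
    refine Finset.sum_pos' (fun l _ => hA.posSemidef.dotProduct_mulVec_nonneg _)
      ⟨k, Finset.mem_univ _, hA.dotProduct_mulVec_pos fun h => hki ?_⟩
    exact congrFun h (Sum.inl i)

/-- The Fourier formula for the inverse of the periodic precision matrix. -/
lemma periodicMatrix_inv_apply (hA : A.PosDef) (k l : ZMod P) (i j : Fin d) :
    (periodicMatrix A P)⁻¹ (k, i) (l, j) =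
      (P : ℂ)⁻¹ * ∑ t : ZMod P, (symbol A (ZMod.stdAddChar t))⁻¹ i j *
        ZMod.stdAddChar (t * (k - l)) := by
  let R : Matrix (ZMod P × Fin d) (ZMod P × Fin d) ℂ := Matrix.of fun a b =>
    (P : ℂ)⁻¹ * ∑ t : ZMod P, (symbol A (ZMod.stdAddChar t))⁻¹ a.2 b.2 *
        ZMod.stdAddChar (t * (a.1 - b.1))
  suffices h : (periodicMatrix A P)⁻¹ = R by rw [h]; rfl
  refine Matrix.inv_eq_right_inv ?_
  have hP : (P : ℂ) ≠ 0 := Nat.cast_ne_zero.2 (NeZero.ne P)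
  ext ⟨k, i⟩ ⟨l, j⟩
  have hnorm : ∀ t : ZMod P, ‖(ZMod.stdAddChar t : ℂ)‖ = 1 := fun t => by
    rw [ZMod.stdAddChar_apply]; exact Circle.norm_coe _
  have hmul : (periodicMatrix A P * R) (k, i) (l, j) =
      (periodicMatrix A P).mulVec (fun a => R a (l, j)) (k, i) := rfl
  have key : ∀ t : ZMod P, ∑ m, (symbol A (ZMod.stdAddChar t)) i m *
      (symbol A (ZMod.stdAddChar t))⁻¹ m j = if i = j then 1 else 0 := fun t => by
    rw [← Matrix.mul_apply, Matrix.mul_nonsing_inv _ (isUnit_det_symbol hA (hnorm t)),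
      Matrix.one_apply]
  have hsum : (periodicMatrix A P * R) (k, i) (l, j) =
      (P : ℂ)⁻¹ * ∑ t : ZMod P, (∑ m, (symbol A (ZMod.stdAddChar t)) i m *
        (symbol A (ZMod.stdAddChar t))⁻¹ m j) * ZMod.stdAddChar (t * (k - l)) := by
    rw [hmul, periodicMatrix_mulVec]
    simp only [Matrix.mulVec, dotProduct, R, Matrix.of_apply]
    -- A shift of the site by ±1 multiplies the character by ζ^{±1}, where ζ is the root of unity
    -- belonging to t. The three terms therefore combine into Φ(ζ), which cancels Φ(ζ)⁻¹.
    have e1 : ∀ t : ZMod P, (ZMod.stdAddChar (t * (k + 1 - l)) : ℂ) =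
        ZMod.stdAddChar t * ZMod.stdAddChar (t * (k - l)) := fun t => by
      rw [← AddChar.map_add_eq_mul]; congr 1; ring
    have e2 : ∀ t : ZMod P, (ZMod.stdAddChar (t * (k - 1 - l)) : ℂ) =
        (ZMod.stdAddChar t)⁻¹ * ZMod.stdAddChar (t * (k - l)) := fun t => by
      rw [← AddChar.map_neg_eq_inv, ← AddChar.map_add_eq_mul]; congr 1; ring
    simp only [e1, e2, symbol, Matrix.add_apply, Matrix.smul_apply, smul_eq_mul, Finset.mul_sum,
      Finset.sum_mul]
    simp only [← Finset.sum_add_distrib]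
    conv_lhs => rw [Finset.sum_comm]
    refine Finset.sum_congr rfl fun t _ => ?_
    refine Finset.sum_congr rfl fun m _ => ?_
    ring
  rw [hsum]
  simp only [key, ite_mul, one_mul, zero_mul]
  rw [Matrix.one_apply]
  by_cases hij : i = j
  · subst hij
    simp only [if_true]
    rw [AddChar.sum_mulShift _ (ZMod.isPrimitive_stdAddChar P), ZMod.card]
    by_cases hkl : k = l
    · subst hkl; simp [hP]
    · simp [hkl, sub_eq_zero]
  · simp [hij]

end Periodic

/-! ### Characteristic functions of the periodic laws -/

section PeriodicLaw

variable {d : ℕ} {A : Matrix (Fin d ⊕ Fin d) (Fin d ⊕ Fin d) ℂ} {P : ℕ} [NeZero P]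

/-- Write Q = B^* B and take `e` to be x ↦ Bx, so that x^* Q x becomes a squared norm. The
conjugated rows of B⁻¹ represent the coordinates of x, and their Gram matrix is B⁻¹ (B⁻¹)^* = Q⁻¹.
-/
lemma exists_periodic_equiv (hA : A.PosDef) (P : ℕ) [NeZero P] :
    ∃ (e : (ZMod P → Fin d → ℂ) ≃L[ℝ] EuclideanSpace ℂ (ZMod P × Fin d))
      (w : ZMod P × Fin d → EuclideanSpace ℂ (ZMod P × Fin d)),
      (∀ x, ‖e x‖ ^ 2 = ∑ a : ZMod P × Fin d, ∑ b : ZMod P × Fin d,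
        (star (x a.1 a.2) * periodicMatrix A P a b * x b.1 b.2).re) ∧
      (∀ a x, inner ℂ (w a) (e x) = x a.1 a.2) ∧
      ∀ a b, inner ℂ (w a) (w b) = (periodicMatrix A P)⁻¹ a b := by
  have hQ := posDef_periodicMatrix (P := P) hA
  obtain ⟨B, hB⟩ : ∃ B : Matrix (ZMod P × Fin d) (ZMod P × Fin d) ℂ,
      periodicMatrix A P = B.conjTranspose * B := by
    open scoped MatrixOrder Matrix.Norms.L2Operator in
    exact CStarAlgebra.nonneg_iff_eq_star_mul_self.1 hQ.posSemidef.nonneg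
  have hBu : IsUnit B.det := by
    have h := (Matrix.isUnit_iff_isUnit_det _).1 hQ.isUnit
    rw [hB, Matrix.det_mul] at h
    exact isUnit_of_mul_isUnit_right h
  let f : (ZMod P → Fin d → ℂ) ≃ₗ[ℂ] EuclideanSpace ℂ (ZMod P × Fin d) :=
    (LinearEquiv.curry ℂ ℂ (ZMod P) (Fin d)).symm.trans
      ((Matrix.toLin'OfInv (Matrix.nonsing_inv_mul B hBu) (Matrix.mul_nonsing_inv B hBu)).trans
        (WithLp.linearEquiv 2 ℂ (ZMod P × Fin d → ℂ)).symm)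
  have hf : ∀ x, f x = WithLp.toLp 2 (B.mulVec (Function.uncurry x)) := fun x => rfl
  let w : ZMod P × Fin d → EuclideanSpace ℂ (ZMod P × Fin d) := fun a =>
    WithLp.toLp 2 fun b => star (B⁻¹ a b)
  refine ⟨(f.restrictScalars ℝ).toContinuousLinearEquiv, w, fun x => ?_, fun a x => ?_,
    fun a b => ?_⟩
  · have h1 : ((‖f x‖ ^ 2 : ℝ) : ℂ) = ∑ a : ZMod P × Fin d, ∑ b : ZMod P × Fin d,
        (star (x a.1 a.2) * periodicMatrix A P a b * x b.1 b.2) := by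
      have h2 : (inner ℂ (f x) (f x) : ℂ) = star (B.mulVec (Function.uncurry x)) ⬝ᵥ
          B.mulVec (Function.uncurry x) := by
        rw [hf, EuclideanSpace.inner_eq_star_dotProduct, dotProduct_comm]
      rw [inner_self_eq_norm_sq_to_K] at h2
      rw [Complex.ofReal_pow]
      refine h2.trans ?_
      rw [Matrix.star_mulVec, ← Matrix.dotProduct_mulVec, Matrix.mulVec_mulVec, ← hB]
      simp only [dotProduct, Matrix.mulVec, Finset.mul_sum, Pi.star_apply, ← mul_assoc]
      rfl
    have h3 := congrArg Complex.re h1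
    simp only [Complex.ofReal_re, Complex.re_sum] at h3
    exact h3
  · change inner ℂ (w a) (f x) = x a.1 a.2
    rw [hf, EuclideanSpace.inner_eq_star_dotProduct, dotProduct_comm]
    have h : star (w a).ofLp ⬝ᵥ B.mulVec (Function.uncurry x) =
        (B⁻¹).mulVec (B.mulVec (Function.uncurry x)) a := by
      simp only [dotProduct, Matrix.mulVec, w, Pi.star_apply, star_star]
    refine h.trans ?_
    rw [Matrix.mulVec_mulVec, Matrix.nonsing_inv_mul B hBu, Matrix.one_mulVec]
    rfl
  · rw [EuclideanSpace.inner_eq_star_dotProduct, hB, Matrix.mul_inv_rev,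
      ← Matrix.conjTranspose_nonsing_inv, dotProduct_comm]
    simp only [dotProduct, w, Pi.star_apply, star_star, Matrix.mul_apply,
      Matrix.conjTranspose_apply]

lemma periodicLaw_eq (e : (ZMod P → Fin d → ℂ) ≃L[ℝ] EuclideanSpace ℂ (ZMod P × Fin d))
    (he : ∀ x, ‖e x‖ ^ 2 = ∑ a : ZMod P × Fin d, ∑ b : ZMod P × Fin d,
      (star (x a.1 a.2) * periodicMatrix A P a b * x b.1 b.2).re) :
    periodicLaw A P =
      (∫⁻ x, ENNReal.ofReal (Real.exp (-(1 / 2 : ℝ) * ‖e x‖ ^ 2)))⁻¹ •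
        (volume : Measure (ZMod P → Fin d → ℂ)).withDensity
          fun x => ENNReal.ofReal (Real.exp (-(1 / 2 : ℝ) * ‖e x‖ ^ 2)) := by
  simp_rw [he]
  rfl

instance isAddHaarMeasure_volume_periodic :
    (volume : Measure (ZMod P → Fin d → ℂ)).IsAddHaarMeasure := by
  rw [volume_pi]
  exact Measure.pi.isAddHaarMeasure _

lemma isProbabilityMeasure_periodicLaw (hA : A.PosDef) :
    IsProbabilityMeasure (periodicLaw A P) := by
  obtain ⟨e, w, he, -, -⟩ := exists_periodic_equiv hA P
  rw [periodicLaw_eq e he]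
  exact isProbabilityMeasure_gaussianWeight volume e

/-- The exponent is the real inner product of `e x` with ∑ c_s w_s, and the double sum is the
squared norm of that vector. -/
lemma integral_exp_periodicLaw (hA : A.PosDef) {σ : Type*} [Fintype σ] (p : σ → ZMod P × Fin d)
    (c : σ → ℂ) :
    ∫ x, Complex.exp (Complex.I * ((∑ s, star (c s) * x (p s).1 (p s).2).re : ℂ))
      ∂(periodicLaw A P) =
      Complex.exp (-(1 / 2) * ∑ s, ∑ t, star (c s) * c t * (periodicMatrix A P)⁻¹ (p s) (p t)) := by
  obtain ⟨e, w, he, hw, hww⟩ := exists_periodic_equiv hA P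
  rw [periodicLaw_eq e he]
  have h := integral_exp_gaussianWeight volume e (∑ s, c s • w (p s))
  have h1 : ∀ x, inner ℝ (∑ s, c s • w (p s)) (e x) = (∑ s, star (c s) * x (p s).1 (p s).2).re :=
    fun x => by
      have h2 : (inner ℂ (∑ s, c s • w (p s)) (e x) : ℂ) = ∑ s, star (c s) * x (p s).1 (p s).2 := by
        rw [sum_inner]
        exact Finset.sum_congr rfl fun s _ => by rw [inner_smul_left, hw]; rfl
      rw [← h2, PiLp.inner_apply, PiLp.inner_apply, Complex.re_sum]
      rfl
  have h2 : ((‖∑ s, c s • w (p s)‖ ^ 2 : ℝ) : ℂ) =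
      ∑ s, ∑ t, star (c s) * c t * (periodicMatrix A P)⁻¹ (p s) (p t) := by
    have h3 := inner_self_eq_norm_sq_to_K (𝕜 := ℂ) (∑ s, c s • w (p s))
    rw [Complex.ofReal_pow]
    refine h3.symm.trans ?_
    rw [sum_inner]
    refine Finset.sum_congr rfl fun s _ => ?_
    rw [inner_sum]
    refine Finset.sum_congr rfl fun t _ => ?_
    rw [inner_smul_left, inner_smul_right, hww, mul_assoc]
    rfl
  simp only [h1] at h
  rw [h, ← h2]
  congr 1
  push_cast
  ring

end PeriodicLaw

/-! ### Averages over roots of unity -/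

section RootsOfUnity

/-- The point of the circle with `e^{iθ} = e^{2πit/P}`. -/
def rootPoint (P : ℕ) [NeZero P] (t : ZMod P) : Torus :=
  AddCircle.homeomorphCircle'.symm (ZMod.toCircle t)

lemma toCircle_rootPoint (P : ℕ) [NeZero P] (t : ZMod P) :
    AddCircle.toCircle (rootPoint P t) = ZMod.toCircle t := by
  have h : ∀ x : Torus, AddCircle.toCircle x = AddCircle.homeomorphCircle' x := fun x => by
    induction x using QuotientAddGroup.induction_on with
    | H x =>
      rw [AddCircle.toCircle_apply_mk]
      change _ = Circle.exp x
      congr 1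
      field_simp
  rw [h, rootPoint, Homeomorph.apply_symm_apply]

lemma fourier_rootPoint (P : ℕ) [NeZero P] (t : ZMod P) (m : ℤ) :
    fourier m (rootPoint P t) = ZMod.stdAddChar (t * (m : ZMod P)) := by
  rw [fourier_apply, AddCircle.toCircle_zsmul, toCircle_rootPoint, ZMod.stdAddChar_apply,
    ← AddChar.map_zsmul_eq_zpow, zsmul_eq_mul, mul_comm]

/-- Averages over the `P`-th roots of unity converge to the integral over the circle. -/
lemma tendsto_average_rootPoint (G : C(Torus, ℂ)) :
    Tendsto (fun P : ℕ => ((P + 1 : ℕ) : ℂ)⁻¹ * ∑ t : ZMod (P + 1), G (rootPoint (P + 1) t)) atTop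
      (𝓝 (∫ θ, G θ ∂AddCircle.haarAddCircle)) := by
  let F : ℕ → C(Torus, ℂ) → ℂ := fun P G =>
    ((P + 1 : ℕ) : ℂ)⁻¹ * ∑ t : ZMod (P + 1), G (rootPoint (P + 1) t)
  let I : C(Torus, ℂ) → ℂ := fun G => ∫ θ, G θ ∂AddCircle.haarAddCircle
  have hint : ∀ G : C(Torus, ℂ), Integrable G (AddCircle.haarAddCircle : Measure Torus) := fun G =>
    G.continuous.integrable_of_hasCompactSupport (HasCompactSupport.of_compactSpace _)
  -- All averages are 1-Lipschitz for the uniform norm, so the functions for which convergence holds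
  -- form a closed set; trigonometric polynomials are dense.
  have hF : Equicontinuous F := by
    refine (LipschitzWith.uniformEquicontinuous F 1 fun P => ?_).equicontinuous
    refine LipschitzWith.of_dist_le_mul fun G H => ?_
    have hP : (0 : ℝ) < (P + 1 : ℕ) := by positivity
    rw [NNReal.coe_one, one_mul, dist_eq_norm, ← mul_sub, ← Finset.sum_sub_distrib, norm_mul,
      norm_inv, Complex.norm_natCast, inv_mul_le_iff₀ hP]
    refine (norm_sum_le _ _).trans ?_
    have h : ∀ t ∈ (Finset.univ : Finset (ZMod (P + 1))),
        ‖G (rootPoint (P + 1) t) - H (rootPoint (P + 1) t)‖ ≤ dist G H := fun t _ => by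
      rw [← dist_eq_norm]; exact ContinuousMap.dist_apply_le_dist _
    refine (Finset.sum_le_card_nsmul _ _ _ h).trans_eq ?_
    rw [Finset.card_univ, ZMod.card, nsmul_eq_mul]
  have hI : Continuous I := by
    refine (LipschitzWith.of_dist_le_mul (K := 1) fun G H => ?_).continuous
    rw [NNReal.coe_one, one_mul, dist_eq_norm, ← integral_sub (hint G) (hint H)]
    refine (norm_integral_le_of_norm_le_const (C := dist G H) (.of_forall fun θ => ?_)).trans_eq ?_
    · rw [← dist_eq_norm]; exact ContinuousMap.dist_apply_le_dist _
    · simp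
  have hclosed := hF.isClosed_setOfPred_tendsto (l := atTop) hI
  have hspan : ∀ G ∈ Submodule.span ℂ (Set.range (fourier (T := 2 * Real.pi))),
      Tendsto (F · G) atTop (𝓝 (I G)) := by
    intro G hG
    induction hG using Submodule.span_induction with
    | mem G h =>
      obtain ⟨m, rfl⟩ := h
      have hIm : I (fourier m) = if m = 0 then 1 else 0 := by
        have h := congrFun (fourierCoeff_fourier (T := 2 * Real.pi) m) 0
        rw [fourierCoeff] at h
        simp only [neg_zero, fourier_zero, one_smul, Pi.single_apply, eq_comm (a := (0 : ℤ))] at h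
        exact h
      rw [hIm]
      refine tendsto_const_nhds.congr' ?_
      -- Once P + 1 > |m|, a nonzero m is not divisible by P + 1, and the average of the character
      -- is exactly 0.
      filter_upwards [eventually_ge_atTop m.natAbs] with P hP'
      have hP : (m.natAbs : ℤ) ≤ P := by exact_mod_cast hP'
      have hP0 : ((P + 1 : ℕ) : ℂ) ≠ 0 := Nat.cast_ne_zero.2 (Nat.succ_ne_zero P)
      simp only [F, fourier_rootPoint]
      rw [AddChar.sum_mulShift _ (ZMod.isPrimitive_stdAddChar (P + 1)), ZMod.card]
      by_cases hm : m = 0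
      · subst hm
        rw [if_pos rfl, if_pos Int.cast_zero, inv_mul_cancel₀ hP0]
      · rw [if_neg hm, if_neg, Nat.cast_zero, mul_zero]
        intro hd
        rw [ZMod.intCast_zmod_eq_zero_iff_dvd] at hd
        have := Int.le_of_dvd (Int.natAbs_pos.2 hm |> Int.natCast_pos.2) (Int.dvd_natAbs.2 hd)
        omega
    | zero =>
      have h1 : ∀ P, F P 0 = 0 := fun P => by simp [F]
      have h2 : I 0 = 0 := by simp [I]
      simp only [h1, h2]
      exact tendsto_const_nhds
    | add G H _ _ hG hH =>
      have h1 : ∀ P, F P (G + H) = F P G + F P H := fun P => by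
        simp [F, Finset.sum_add_distrib, mul_add]
      have h2 : I (G + H) = I G + I H := integral_add (hint G) (hint H)
      simp only [h1, h2]
      exact hG.add hH
    | smul c G _ hG =>
      have h1 : ∀ P, F P (c • G) = c * F P G := fun P => by
        simp only [F, ContinuousMap.smul_apply, smul_eq_mul, ← Finset.mul_sum]; ring
      have h2 : I (c • G) = c * I G := integral_const_mul c G
      simp only [h1, h2]
      exact hG.const_mul c
  have hd : G ∈ closure
      (Submodule.span ℂ (Set.range (fourier (T := 2 * Real.pi))) : Set C(Torus, ℂ)) := by
    rw [← Submodule.topologicalClosure_coe, span_fourier_closure_eq_top]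
    trivial
  exact closure_minimal (fun G hG => hspan G hG) hclosed hd

end RootsOfUnity

/-! ### Convergence of the periodic covariances and characteristic functions -/

section Limit

variable {d : ℕ} {A : Matrix (Fin d ⊕ Fin d) (Fin d ⊕ Fin d) ℂ}

lemma tendsto_periodicMatrix_inv (hA : A.PosDef) (k l : ℤ) (i j : Fin d) :
    Tendsto (fun P : ℕ => (periodicMatrix A (P + 1))⁻¹ ((k : ZMod (P + 1)), i) ((l : ZMod (P + 1)), j))
      atTop (𝓝 (invCoeff A (l - k) i j)) := by
  let G : C(Torus, ℂ) := ⟨fun θ => fourier (-(l - k)) θ •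
    (symbol A (AddCircle.toCircle θ : ℂ))⁻¹ i j,
    (fourier _).continuous.smul ((continuous_symbol_inv_toCircle hA).matrix_elem i j)⟩
  have h := tendsto_average_rootPoint G
  have h1 : ∫ θ, G θ ∂AddCircle.haarAddCircle = invCoeff A (l - k) i j := by
    rw [← fourierCoeff_symbol_inv]; rfl
  rw [h1] at h
  refine h.congr fun P => ?_
  rw [periodicMatrix_inv_apply hA]
  congr 1
  refine Finset.sum_congr rfl fun t _ => ?_
  change fourier (-(l - k)) (rootPoint (P + 1) t) •
    (symbol A (AddCircle.toCircle (rootPoint (P + 1) t) : ℂ))⁻¹ i j = _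
  rw [fourier_rootPoint, toCircle_rootPoint, ← ZMod.stdAddChar_apply, smul_eq_mul, mul_comm,
    neg_sub, Int.cast_sub]

lemma tendsto_integral_exp_periodicLaw (hA : A.PosDef) {σ : Type*} [Fintype σ] (s : σ → ℤ)
    (c : σ → Fin d → ℂ) :
    Tendsto (fun P : ℕ => ∫ x, Complex.exp (Complex.I *
        ((∑ k, ∑ i, star (c k i) * x (s k : ZMod (P + 1)) i).re : ℂ)) ∂(periodicLaw A (P + 1)))
      atTop (𝓝 (Complex.exp (-(1 / 2) * ∑ k, ∑ i, ∑ l, ∑ j,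
        star (c k i) * c l j * invCoeff A (s l - s k) i j))) := by
  have h : ∀ P : ℕ, ∫ x, Complex.exp (Complex.I *
        ((∑ k, ∑ i, star (c k i) * x (s k : ZMod (P + 1)) i).re : ℂ)) ∂(periodicLaw A (P + 1)) =
      Complex.exp (-(1 / 2) * ∑ k, ∑ i, ∑ l, ∑ j, star (c k i) * c l j *
        (periodicMatrix A (P + 1))⁻¹ ((s k : ZMod (P + 1)), i) ((s l : ZMod (P + 1)), j)) := by
    intro P
    have := integral_exp_periodicLaw (P := P + 1) hA
      (fun q : σ × Fin d => ((s q.1 : ZMod (P + 1)), q.2)) (fun q => c q.1 q.2)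
    simpa only [Fintype.sum_prod_type] using this
  simp only [h]
  refine (Complex.continuous_exp.tendsto _).comp (Tendsto.const_mul _ ?_)
  refine tendsto_finsetSum _ fun k _ => tendsto_finsetSum _ fun i _ =>
    tendsto_finsetSum _ fun l _ => tendsto_finsetSum _ fun j _ => Tendsto.const_mul _ ?_
  exact tendsto_periodicMatrix_inv hA (s k) (s l) i j

lemma tendsto_charFun_periodicLaw (hA : A.PosDef) (α : ℤ →₀ (Fin d → ℂ)) :
    Tendsto
      (fun P : ℕ => ∫ x, Complex.exp (Complex.I *
          ((α.sum fun k a => star a ⬝ᵥ x (k : ZMod (P + 1))).re : ℂ)) ∂(periodicLaw A (P + 1)))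
      atTop
      (𝓝 (Complex.exp (-(1 / 2) * α.sum fun k a => α.sum fun l b =>
        star a ⬝ᵥ (invCoeff A (l - k)).mulVec b))) := by
  have h := tendsto_integral_exp_periodicLaw hA (σ := α.support) (fun k => (k : ℤ)) fun k => α k
  convert h using 5 with P x
  · congr 4
    rw [Finsupp.sum, ← Finset.sum_coe_sort]
    rfl
  · rw [Finsupp.sum, ← Finset.sum_coe_sort]
    refine Finset.sum_congr rfl fun k _ => ?_
    rw [Finset.sum_comm' (s := Finset.univ) (t := fun _ => Finset.univ) (t' := Finset.univ)
      (s' := fun _ => Finset.univ) (by simp)]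
    rw [Finsupp.sum, ← Finset.sum_coe_sort]
    refine Finset.sum_congr rfl fun l _ => ?_
    simp only [dotProduct, Matrix.mulVec, Finset.mul_sum, Pi.star_apply]
    refine Finset.sum_congr rfl fun i _ => Finset.sum_congr rfl fun j _ => ?_
    ring

end Limit

/-! ### First properties of Gaussian isometries -/

section Isometry

variable {d : ℕ} {A : Matrix (Fin d ⊕ Fin d) (Fin d ⊕ Fin d) ℂ} {Ω : Type*} [MeasurableSpace Ω]
  {μ : Measure Ω} {X : SymbolSpace d →ₗ[ℂ] Lp ℂ 2 μ}

/-- The isometry controls norms only. The square root S of the form makes polarization available on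
both sides. -/
lemma IsGaussianIsometry.inner_map (hX : IsGaussianIsometry A μ X) (hA : A.PosDef)
    (f g : SymbolSpace d) : inner ℂ (X f) (X g) = symbolInner A f g := by
  obtain ⟨S, hS⟩ := exists_inner_eq_symbolInner hA
  have h : ∀ f, ‖X f‖ = ‖S f‖ := fun f => by
    have h1 := hX.isometry f
    rw [← hS, inner_self_eq_norm_sq_to_K] at h1
    exact (pow_left_inj₀ (norm_nonneg _) (norm_nonneg _) two_ne_zero).1
      (Complex.ofReal_injective (by simpa using h1))
  rw [← hS, inner_eq_sum_norm_sq_div_four, inner_eq_sum_norm_sq_div_four (S f)]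
  simp only [← map_add, ← map_sub, ← map_smul, h]

lemma IsGaussianIsometry.norm_sq_sum (hX : IsGaussianIsometry A μ X) (hA : A.PosDef)
    {σ ι : Type*} [Fintype σ] [Fintype ι] (c : σ → ι → ℂ) (f : σ → ι → SymbolSpace d) :
    ((‖X (∑ k, ∑ i, c k i • f k i)‖ ^ 2 : ℝ) : ℂ) =
      ∑ k, ∑ i, ∑ l, ∑ j, star (c k i) * c l j * symbolInner A (f k i) (f l j) := by
  have h := inner_self_eq_norm_sq_to_K (𝕜 := ℂ) (X (∑ k, ∑ i, c k i • f k i))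
  rw [Complex.ofReal_pow]
  refine h.symm.trans ?_
  simp only [← hX.inner_map hA]
  conv_lhs => rw [map_sum, sum_inner]
  refine Finset.sum_congr rfl fun k _ => ?_
  rw [map_sum, sum_inner]
  refine Finset.sum_congr rfl fun i _ => ?_
  rw [inner_sum]
  refine Finset.sum_congr rfl fun l _ => ?_
  rw [map_sum, inner_sum]
  refine Finset.sum_congr rfl fun j _ => ?_
  rw [map_smul, map_smul, inner_smul_left, inner_smul_right, mul_assoc]
  rfl

lemma measurable_gibbsProcess (k : ℤ) : Measurable (gibbsProcess X k) :=
  measurable_pi_lambda _ fun _ => measurable_coeFn _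

lemma IsGaussianIsometry.isGaussianProcess_gibbsProcess (hX : IsGaussianIsometry A μ X) :
    IsGaussianProcess (gibbsProcess X) μ := by
  classical
  refine hX.gaussian.of_isGaussianProcess fun k => ⟨Finset.univ.image (waveVec k),
    ContinuousLinearMap.pi fun i => ContinuousLinearMap.proj
      ⟨waveVec k i, Finset.mem_image_of_mem _ (Finset.mem_univ i)⟩, fun ω => rfl⟩

/-- The conjugated variable is the first argument of the inner product of L², so the indices appear
transposed. -/
lemma IsGaussianIsometry.integrable_and_integral_mul_star (hX : IsGaussianIsometry A μ X)
    (hA : A.PosDef) (k l : ℤ) (i j : Fin d) :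
    Integrable (fun ω => gibbsProcess X k ω i * star (gibbsProcess X l ω j)) μ ∧
      ∫ ω, gibbsProcess X k ω i * star (gibbsProcess X l ω j) ∂μ = invCoeff A (l - k) j i := by
  have h1 := L2.integrable_inner (𝕜 := ℂ) (X (waveVec l j)) (X (waveVec k i))
  have h2 := hX.inner_map hA (waveVec l j) (waveVec k i)
  rw [symbolInner_waveVec, L2.inner_def] at h2
  exact ⟨h1, h2⟩

variable [IsProbabilityMeasure μ]

lemma IsGaussianIsometry.hasGaussianCharFun (hX : IsGaussianIsometry A μ X) :
    HasGaussianCharFun X :=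
  GaussMarkov.hasGaussianCharFun hX.gaussian hX.circular

lemma IsGaussianIsometry.isTranslationInvariant_gibbsProcess (hX : IsGaussianIsometry A μ X)
    (hA : A.PosDef) : IsTranslationInvariant μ (gibbsProcess X) := by
  intro n
  have hm : ∀ n : ℤ, Measurable fun ω (k : ℤ) => gibbsProcess X (k + n) ω := fun n =>
    measurable_pi_lambda _ fun k => measurable_gibbsProcess _
  have hm' : Measurable fun ω (k : ℤ) => gibbsProcess X k ω :=
    measurable_pi_lambda _ fun k => measurable_gibbsProcess _
  have := Measure.isProbabilityMeasure_map (μ := μ) hm'.aemeasurable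
  -- A law on sequences is determined by its finite-dimensional marginals, and for these the norms
  -- involve differences of sites only.
  refine IsProjectiveLimit.unique (P := fun J : Finset ℤ =>
    (μ.map fun ω (k : ℤ) => gibbsProcess X k ω).map J.restrict) (fun J => ?_) fun J => rfl
  simp only
  rw [Measure.map_map (by fun_prop) (hm n), Measure.map_map (by fun_prop) hm']
  refine hX.hasGaussianCharFun.map_eq (fun (k : J) i => waveVec (k + n) i)
    (fun (k : J) i => waveVec k i) fun c => ?_
  refine (pow_left_inj₀ (norm_nonneg _) (norm_nonneg _) two_ne_zero).1 (Complex.ofReal_injective ?_)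
  simp only [hX.norm_sq_sum hA, symbolInner_waveVec, add_sub_add_right_eq_sub]

/-- Lévy's continuity theorem, applied after flattening the values at S into one Euclidean space. -/
lemma IsGaussianIsometry.isThermodynamicLimit_limitProcess (hX : IsGaussianIsometry A μ X)
    (hA : A.PosDef) : IsThermodynamicLimit A μ (limitProcess X) := by
  intro S g
  let u : EuclideanSpace ℂ (S × Fin d) → S → Fin d → ℂ := fun v k i => v (k, i)
  have hu : Continuous u := by fun_prop
  have hν : ∀ P : ℕ, Measurable fun x : ZMod (P + 1) → Fin d → ℂ =>
      (WithLp.toLp 2 fun q : S × Fin d => x ((q.1 : ℤ) : ZMod (P + 1)) q.2 :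
        EuclideanSpace ℂ (S × Fin d)) := fun P => by
    refine (WithLp.measurable_toLp 2 _).comp ?_
    fun_prop
  have hY : Measurable fun ω => (WithLp.toLp 2 fun q : S × Fin d => limitProcess X q.1 ω q.2 :
      EuclideanSpace ℂ (S × Fin d)) := by
    refine (WithLp.measurable_toLp 2 _).comp (measurable_pi_lambda _ fun q => ?_)
    exact (Complex.continuous_conj.measurable.comp (measurable_coeFn _)).const_mul _
  have hP : ∀ P : ℕ, IsProbabilityMeasure (periodicLaw A (P + 1)) := fun P =>
    isProbabilityMeasure_periodicLaw hA
  let ν : ℕ → ProbabilityMeasure (EuclideanSpace ℂ (S × Fin d)) := fun P =>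
    ⟨(periodicLaw A (P + 1)).map _, Measure.isProbabilityMeasure_map (hν P).aemeasurable⟩
  let ν₀ : ProbabilityMeasure (EuclideanSpace ℂ (S × Fin d)) :=
    ⟨μ.map _, Measure.isProbabilityMeasure_map hY.aemeasurable⟩
  have hinner : ∀ (v : S × Fin d → ℂ) (t : EuclideanSpace ℂ (S × Fin d)),
      inner ℝ (WithLp.toLp 2 v) t = (∑ k, ∑ i, star (t (k, i)) * v (k, i)).re := fun v t => by
    rw [PiLp.inner_apply, Fintype.sum_prod_type]
    simp only [Complex.re_sum, Complex.inner]
    refine Finset.sum_congr rfl fun k _ => Finset.sum_congr rfl fun i _ => ?_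
    simp [mul_comm]
  have hlim : Tendsto ν atTop (𝓝 ν₀) := by
    refine ProbabilityMeasure.tendsto_of_tendsto_charFun fun t => ?_
    have h := tendsto_integral_exp_periodicLaw hA (σ := S) (fun k => (k : ℤ)) fun k i => t (k, i)
    convert h using 1
    · funext P
      simp only [ν, ProbabilityMeasure.coe_mk, charFun_apply]
      rw [integral_map (hν P).aemeasurable (by fun_prop)]
      simp only [hinner, mul_comm Complex.I]
    · congr 1
      simp only [ν₀, ProbabilityMeasure.coe_mk, charFun_apply]
      rw [integral_map hY.aemeasurable (by fun_prop)]
      have h1 := hX.hasGaussianCharFun.integral_exp_sum (σ := S)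
        (fun k i => (Real.sqrt 2 : ℂ) * t (k, i)) fun k i => waveVec (-(k : ℤ)) i
      have h2 := hX.norm_sq_sum hA (σ := S)
        (fun k i => (Real.sqrt 2 : ℂ) * t (k, i)) fun k i => waveVec (-(k : ℤ)) i
      -- Conjugating inside the real part removes the conjugation of X and moves it off the
      -- coefficients, leaving a complex linear combination of the X(f). The reflection k ↦ -k then
      -- yields C_{l-k}, and the two factors √2 turn 1/4 into 1/2.
      have h3 : ∀ ω, inner ℝ (WithLp.toLp 2 fun q : S × Fin d => limitProcess X q.1 ω q.2) t =
          (∑ k : S, ∑ i, (Real.sqrt 2 : ℂ) * t (k, i) * X (waveVec (-(k : ℤ)) i) ω).re :=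
        fun ω => by
          rw [hinner, ← Complex.conj_re, map_sum]
          simp only [map_sum]
          congr 1
          refine Finset.sum_congr rfl fun k _ => Finset.sum_congr rfl fun i _ => ?_
          simp [limitProcess, gibbsProcess]
          ring
      simp only [h3]
      rw [h1]
      congr 1
      have h4 : -((‖X (∑ k : S, ∑ i, ((Real.sqrt 2 : ℂ) * t (k, i)) •
          waveVec (-(k : ℤ)) i)‖ ^ 2 / 4 : ℝ) : ℂ) = -(1 / 4) * ((‖X (∑ k : S, ∑ i,
            ((Real.sqrt 2 : ℂ) * t (k, i)) • waveVec (-(k : ℤ)) i)‖ ^ 2 : ℝ) : ℂ) := by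
        push_cast; ring
      rw [h4, h2]
      simp only [Finset.mul_sum]
      refine Finset.sum_congr rfl fun k _ => Finset.sum_congr rfl fun i _ =>
        Finset.sum_congr rfl fun l _ => Finset.sum_congr rfl fun j _ => ?_
      rw [symbolInner_waveVec, show -(k : ℤ) - -(l : ℤ) = l - k by ring]
      have h5 : (Real.sqrt 2 : ℂ) * Real.sqrt 2 = 2 := by
        rw [← Complex.ofReal_mul, Real.mul_self_sqrt (by norm_num)]; norm_num
      rw [StarMul.star_mul, Complex.star_def, Complex.conj_ofReal]
      linear_combination (-(1 / 4) * (starRingEnd ℂ) (t (k, i)) * t (l, j) *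
        invCoeff A (l - k) i j) * h5
  have h := ProbabilityMeasure.tendsto_iff_forall_integral_tendsto.1 hlim
    (g.compContinuous ⟨u, hu⟩)
  have e1 : ∀ P, ∫ v, g.compContinuous ⟨u, hu⟩ v ∂(ν P : Measure _) =
      ∫ x, g (fun k => x ((k : ℤ) : ZMod (P + 1))) ∂(periodicLaw A (P + 1)) := fun P => by
    simp only [ν, ProbabilityMeasure.coe_mk]
    rw [integral_map (hν P).aemeasurable
      (BoundedContinuousFunction.continuous _).aestronglyMeasurable]
    rfl
  have e2 : ∫ v, g.compContinuous ⟨u, hu⟩ v ∂(ν₀ : Measure _) =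
      ∫ ω, g (fun k => limitProcess X k ω) ∂μ := by
    simp only [ν₀, ProbabilityMeasure.coe_mk]
    rw [integral_map hY.aemeasurable
      (BoundedContinuousFunction.continuous _).aestronglyMeasurable]
    rfl
  simpa only [e1, e2] using h

end Isometry

/-! ### Regression on boundary sites -/

section Regression

/-- In a Hilbert space, a vector of the closed span of an orthonormal family that is orthogonal to
all but finitely many of its members is in the span of these. -/
lemma eq_sum_of_mem_topologicalClosure_span {H β : Type*} [NormedAddCommGroup H]
    [InnerProductSpace ℂ H] {u : β → H} (hu : Orthonormal ℂ u) {V : Set β}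
    {B : Finset β} {g : H} (hg : g ∈ (Submodule.span ℂ (u '' V)).topologicalClosure)
    (h : ∀ a ∈ V, a ∉ B → inner ℂ (u a) g = 0) (hB : ∀ b ∈ B, b ∈ V) :
    g = ∑ b ∈ B, inner ℂ (u b) g • u b := by
  classical
  set g' := g - ∑ b ∈ B, inner ℂ (u b) g • u b with hg'
  have h1 : g' ∈ (Submodule.span ℂ (u '' V)).topologicalClosure :=
    Submodule.sub_mem _ hg (Submodule.sum_mem _ fun b hb => Submodule.smul_mem _ _
      (Submodule.le_topologicalClosure _ (Submodule.subset_span ⟨b, hB b hb, rfl⟩)))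
  have h2 : ∀ a ∈ V, inner ℂ (u a) g' = 0 := fun a ha => by
    rw [hg', inner_sub_right, inner_sum]
    simp only [inner_smul_right, orthonormal_iff_ite.1 hu, mul_ite, mul_one, mul_zero]
    rw [Finset.sum_ite_eq]
    split_ifs with hb
    · exact sub_self _
    · rw [h a ha hb, sub_zero]
  -- The difference g' is orthogonal to the closed span in which it lies, hence to itself.
  have h3 : (Submodule.span ℂ (u '' V)).topologicalClosure ≤ (Submodule.span ℂ {g'})ᗮ := by
    refine Submodule.topologicalClosure_minimal _ (Submodule.span_le.2 ?_)
      (Submodule.isClosed_orthogonal _)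
    rintro _ ⟨a, ha, rfl⟩
    rw [SetLike.mem_coe, Submodule.mem_orthogonal_singleton_iff_inner_left]
    exact h2 a ha
  have h4 := Submodule.mem_orthogonal_singleton_iff_inner_left.1 (h3 h1)
  exact sub_eq_zero.1 (inner_self_eq_zero.1 h4)

variable {d : ℕ} {A : Matrix (Fin d ⊕ Fin d) (Fin d ⊕ Fin d) ℂ}

/-- From S^* S = Φ⁻¹ it follows that Φ S^* is a left inverse of S. Thus S realises the geometry of H
inside the ordinary L², and L carries projections back. -/
lemma exists_leftInverse_sqrt (hA : A.PosDef) :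
    ∃ S L : SymbolSpace d →L[ℂ] SymbolSpace d,
      (∀ f g, inner ℂ (S f) (S g) = symbolInner A f g) ∧ ∀ f, L (S f) = f := by
  obtain ⟨S, hS⟩ := exists_inner_eq_symbolInner hA
  refine ⟨S, precOp A ∘L S.adjoint, hS, fun f => ?_⟩
  have h : S.adjoint (S f) = covOp hA f := ext_inner_left ℂ fun g => by
    rw [ContinuousLinearMap.adjoint_inner_right, hS, symbolInner_eq hA]
  rw [ContinuousLinearMap.comp_apply, h, precOp_covOp]

/-- Let all neighbours of the sites `I ⊆ V` be in `V`. The projection of `X_{v,j}`, `v ∈ V`, on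
the sites outside `I` is a function of the sites in `V \ I = B`. -/
lemma exists_regression (hA : A.PosDef) {V I : Set ℤ} {B : Finset ℤ} (hIV : I ⊆ V)
    (hI : ∀ a ∈ I, a + 1 ∈ V ∧ a - 1 ∈ V) (hB : ∀ b, b ∈ B ↔ b ∈ V ∧ b ∉ I)
    {v : ℤ} (hv : v ∈ V) (j : Fin d) :
    ∃ c : ℤ → Fin d → ℂ, ∀ b ∉ I, ∀ i, symbolInner A (waveVec b i)
      (waveVec v j - ∑ b ∈ B, ∑ i, c b i • waveVec b i) = 0 := by
  obtain ⟨S, L, hS, hL⟩ := exists_leftInverse_sqrt hA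
  let U : Submodule ℂ (SymbolSpace d) :=
    Submodule.span ℂ ((fun p : ℤ × Fin d => precOp A (waveVec p.1 p.2)) '' {p | p.1 ∈ I})
  let K : Submodule ℂ (SymbolSpace d) := (U.map S.toLinearMap).topologicalClosure
  have hKc : IsClosed (K : Set (SymbolSpace d)) := Submodule.isClosed_topologicalClosure _
  have : CompleteSpace K := hKc.completeSpace_coe
  set p : SymbolSpace d := K.starProjection (S (waveVec v j)) with hp
  have hpK : p ∈ K := Submodule.starProjection_apply_mem K _
  -- S ∘ L is the identity on the range of S, and by continuity on the closure K.
  have hSL : S (L p) = p := by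
    have hcl : IsClosed {q | S (L q) = q} := isClosed_eq (by fun_prop) continuous_id
    have h : (U.map S.toLinearMap : Set (SymbolSpace d)) ⊆ {q | S (L q) = q} := by
      rintro _ ⟨f, -, rfl⟩
      change S (L (S f)) = S f
      rw [hL]
    exact closure_minimal h hcl hpK
  have hLp : L p ∈ U.topologicalClosure := by
    have hcl : IsClosed {q | L q ∈ U.topologicalClosure} :=
      U.isClosed_topologicalClosure.preimage L.continuous
    have h : (U.map S.toLinearMap : Set (SymbolSpace d)) ⊆ {q | L q ∈ U.topologicalClosure} := by
      rintro _ ⟨f, hf, rfl⟩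
      change L (S f) ∈ U.topologicalClosure
      rw [hL]
      exact U.le_topologicalClosure hf
    exact closure_minimal h hcl hpK
  let W : Set (ℤ × Fin d) := {p | p.1 ∈ V}
  let u : ℤ × Fin d → SymbolSpace d := fun p => waveVec p.1 p.2
  -- By nearest-neighbour coupling, the precision vectors of interior sites are supported in V.
  have hUW : U ≤ Submodule.span ℂ (u '' W) := by
    refine Submodule.span_le.2 ?_
    rintro _ ⟨⟨a, i⟩, ha, rfl⟩
    simp only [precOp_waveVec]
    have hmem : ∀ k ∈ V, ∀ i, waveVec k i ∈ Submodule.span ℂ (u '' W) := fun k hk i =>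
      Submodule.subset_span ⟨(k, i), hk, rfl⟩
    refine Submodule.sum_mem _ fun i' _ => Submodule.add_mem _ (Submodule.add_mem _ ?_ ?_) ?_
    · exact Submodule.smul_mem _ _ (hmem _ (hIV ha) _)
    · exact Submodule.smul_mem _ _ (hmem _ (hI a ha).1 _)
    · exact Submodule.smul_mem _ _ (hmem _ (hI a ha).2 _)
  have hg : waveVec v j - L p ∈ (Submodule.span ℂ (u '' W)).topologicalClosure :=
    Submodule.sub_mem _ (Submodule.le_topologicalClosure _ (Submodule.subset_span ⟨(v, j), hv, rfl⟩))
      (Submodule.topologicalClosure_mono hUW hLp)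
  -- By duality, the L² pairing with a wave at a site of I is the H pairing with a generator of U,
  -- which vanishes because the vector is a projection residual. Only boundary coefficients survive.
  have hperp : ∀ a ∈ W, a ∉ B ×ˢ (Finset.univ : Finset (Fin d)) →
      inner ℂ (u a) (waveVec v j - L p) = 0 := by
    rintro ⟨a, i⟩ ha haB
    have haI : a ∈ I := by
      by_contra h
      exact haB (Finset.mem_product.2 ⟨(hB a).2 ⟨ha, h⟩, Finset.mem_univ _⟩)
    rw [← symbolInner_precOp_left hA, ← hS, map_sub, hSL]
    have h := Submodule.sub_starProjection_mem_orthogonal (K := K) (S (waveVec v j))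
    refine (Submodule.mem_orthogonal _ _).1 h _ (Submodule.le_topologicalClosure _ ?_)
    exact ⟨_, Submodule.subset_span ⟨(a, i), haI, rfl⟩, rfl⟩
  have heq := eq_sum_of_mem_topologicalClosure_span (u := u) orthonormal_waveVec hg hperp
    fun b hb => ((hB _).1 (Finset.mem_product.1 hb).1).1
  rw [Finset.sum_product] at heq
  refine ⟨fun b i => inner ℂ (waveVec b i) (waveVec v j - L p), fun b hb i => ?_⟩
  have heq' : waveVec v j - ∑ b ∈ B, ∑ i, inner ℂ (waveVec b i) (waveVec v j - L p) •
      waveVec b i = L p := by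
    rw [sub_eq_iff_eq_add, ← sub_eq_iff_eq_add']
    exact heq
  rw [heq', ← hS, hSL]
  -- Duality again: a precision vector at a site of I is H-orthogonal to the waves at all other
  -- sites, hence to those outside I.
  have hle : K ≤ (Submodule.span ℂ {S (waveVec b i)})ᗮ := by
    refine Submodule.topologicalClosure_minimal _ ?_ (Submodule.isClosed_orthogonal _)
    rw [Submodule.map_le_iff_le_comap]
    refine Submodule.span_le.2 ?_
    rintro _ ⟨⟨a, i'⟩, ha, rfl⟩
    rw [SetLike.mem_coe, Submodule.mem_comap, Submodule.mem_orthogonal_singleton_iff_inner_left]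
    change inner ℂ (S (precOp A (waveVec a i'))) (S (waveVec b i)) = 0
    rw [hS, symbolInner_precOp_left hA]
    refine orthonormal_waveVec.2 (i := (a, i')) (j := (b, i)) fun h => hb ?_
    obtain ⟨rfl, -⟩ := Prod.mk.inj h
    exact ha
  exact Submodule.mem_orthogonal_singleton_iff_inner_right.1 (hle hpK)

end Regression

/-! ### Conditional expectations of functions of independent variables -/

section CondExp

variable {Ω α ρ : Type*} [mΩ : MeasurableSpace Ω] [mα : MeasurableSpace α] [MeasurableSpace ρ]
  {μ : Measure Ω} [IsProbabilityMeasure μ]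

/-- The joint law of Z and R is a product, so Fubini's theorem identifies the integrals over all
events of σ(Z): the noise is integrated out with Z frozen. -/
lemma condExp_comp_prodMk_of_indepFun {Z : Ω → α} {R : Ω → ρ} (hZ : Measurable Z)
    (hR : Measurable R) (h : IndepFun Z R μ) {F : α × ρ → ℂ} (hF : Measurable F) {c : ℝ}
    (hc : ∀ x, ‖F x‖ ≤ c) :
    condExp (mα.comap Z) μ (fun ω => F (Z ω, R ω)) =ᵐ[μ]
      fun ω => ∫ r, F (Z ω, r) ∂(μ.map R) := by
  have := Measure.isProbabilityMeasure_map (μ := μ) hZ.aemeasurable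
  have := Measure.isProbabilityMeasure_map (μ := μ) hR.aemeasurable
  have hprod := (indepFun_iff_map_prod_eq_prod_map_map hZ.aemeasurable hR.aemeasurable).1 h
  have hint : StronglyMeasurable fun z => ∫ r, F (z, r) ∂(μ.map R) :=
    hF.stronglyMeasurable.integral_prod_right'
  have hb : ∀ z, ‖∫ r, F (z, r) ∂(μ.map R)‖ ≤ c := fun z =>
    (norm_integral_le_of_norm_le_const (.of_forall fun r => hc (z, r))).trans_eq (by simp)
  refine (ae_eq_condExp_of_forall_setIntegral_eq hZ.comap_le ?_ ?_ ?_ ?_).symm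
  · exact Integrable.of_bound (hF.comp (hZ.prodMk hR)).aestronglyMeasurable c
      (.of_forall fun ω => hc _)
  · exact fun s _ _ => (Integrable.of_bound (hint.comp_measurable hZ).aestronglyMeasurable c
      (.of_forall fun ω => hb _)).integrableOn
  · rintro s ⟨t, ht, rfl⟩ -
    have e1 : ∫ ω in Z ⁻¹' t, (∫ r, F (Z ω, r) ∂(μ.map R)) ∂μ =
        ∫ z in t, (∫ r, F (z, r) ∂(μ.map R)) ∂(μ.map Z) :=
      (setIntegral_map ht hint.aestronglyMeasurable hZ.aemeasurable).symm
    have e2 : ∫ ω in Z ⁻¹' t, F (Z ω, R ω) ∂μ =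
        ∫ x in t ×ˢ Set.univ, F x ∂((μ.map Z).prod (μ.map R)) := by
      rw [← hprod, setIntegral_map (ht.prod MeasurableSet.univ) hF.aestronglyMeasurable
        (hZ.prodMk hR).aemeasurable]
      congr 2
      ext ω; simp
    rw [e1, e2, setIntegral_prod, Measure.restrict_univ]
    exact (Integrable.of_bound hF.aestronglyMeasurable c (.of_forall hc)).integrableOn
  · exact (hint.comp_measurable (comap_measurable Z)).aestronglyMeasurable

/-- If the variables `Y_i` are functions of parts `π_i Z` of `Z` and of noises `R_i` such that `Z`,
`(R_i)` are independent, then the `Y_i` are conditionally independent given `Z`, and each depends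
on `Z` through `π_i Z` only. -/
lemma condExp_prod_eq_prod_condExp {ι : Type*} [Fintype ι] {β ρ : ι → Type*}
    [mβ : ∀ i, MeasurableSpace (β i)] [∀ i, MeasurableSpace (ρ i)] {Z : Ω → α} (hZ : Measurable Z)
    {p : ∀ i, α → β i} (hp : ∀ i, Measurable (p i)) {R : ∀ i, Ω → ρ i} (hR : ∀ i, Measurable (R i))
    (hRR : iIndepFun R μ) (hZR : IndepFun Z (fun ω i => R i ω) μ) {F : ∀ i, β i × ρ i → ℂ}
    (hF : ∀ i, Measurable (F i)) (hb : ∀ i, ∃ c : ℝ, ∀ x, ‖F i x‖ ≤ c) :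
    condExp (mα.comap Z) μ (fun ω => ∏ i, F i (p i (Z ω), R i ω)) =ᵐ[μ]
      fun ω => ∏ i, condExp ((mβ i).comap fun ω => p i (Z ω)) μ
        (fun ω => F i (p i (Z ω), R i ω)) ω := by
  choose c hc using hb
  have hRm : Measurable fun ω i => R i ω := measurable_pi_lambda _ hR
  have h1 := condExp_comp_prodMk_of_indepFun hZ hRm hZR
    (F := fun x => ∏ i, F i (p i x.1, x.2 i)) (by fun_prop) (c := ∏ i, c i) fun x => by
      rw [norm_prod]
      exact Finset.prod_le_prod (fun i _ => norm_nonneg _) fun i _ => hc i _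
  have h2 : ∀ᵐ ω ∂μ, ∀ i, condExp ((mβ i).comap fun ω => p i (Z ω)) μ
      (fun ω => F i (p i (Z ω), R i ω)) ω = ∫ r, F i (p i (Z ω), r) ∂(μ.map (R i)) := by
    refine ae_all_iff.2 fun i => ?_
    exact condExp_comp_prodMk_of_indepFun ((hp i).comp hZ) (hR i)
      (hZR.comp (hp i) (measurable_pi_apply i)) (hF i) (hc i)
  have hlaw := (iIndepFun_iff_map_fun_eq_pi_map fun i => (hR i).aemeasurable).1 hRR
  have hpr : ∀ i, IsProbabilityMeasure (μ.map (R i)) := fun i =>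
    Measure.isProbabilityMeasure_map (hR i).aemeasurable
  filter_upwards [h1, h2] with ω e1 e2
  rw [e1, hlaw, integral_fintype_prod_eq_prod (𝕜 := ℂ) (fun i r => F i (p i (Z ω), r))]
  exact Finset.prod_congr rfl fun i _ => (e2 i).symm

end CondExp

/-! ### Independence of orthogonal Gaussian families -/

section Independence

variable {Ω : Type*} [MeasurableSpace Ω] {μ : Measure Ω} [IsProbabilityMeasure μ]
  {V : Type*} [AddCommGroup V] [Module ℂ V] {X : V →ₗ[ℂ] Lp ℂ 2 μ}

lemma exists_eq_re_mul (L : StrongDual ℝ ℂ) : ∃ c : ℂ, ∀ z, L z = (c * z).re := by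
  obtain ⟨c, hc⟩ := exists_eq_re_sum (L.comp (ContinuousLinearMap.proj (R := ℝ)
    (φ := fun _ : Unit => ℂ) ()))
  exact ⟨c (), fun z => by simpa using hc fun _ => z⟩

/-- A real functional of X(f) is the real part of X(cf), and circularity expresses covariances of
real parts by the Hermitian inner product alone. Complex orthogonality therefore suffices for
independence. -/
lemma covariance_strongDual_eq_zero (hc : IsCircular X) {f g : V} (h : inner ℂ (X f) (X g) = 0)
    (L₁ L₂ : StrongDual ℝ ℂ) : cov[L₁ ∘ X f, L₂ ∘ X g; μ] = 0 := by
  have hL : ∀ (L : StrongDual ℝ ℂ) (f : V), ∃ c : ℂ, L ∘ X f =ᵐ[μ] fun ω => (X (c • f) ω).re := by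
    intro L f
    obtain ⟨c, hc⟩ := exists_eq_re_mul L
    refine ⟨c, ?_⟩
    rw [map_smul]
    filter_upwards [Lp.coeFn_smul c (X f)] with ω h
    rw [h, Function.comp_apply, hc]
    rfl
  obtain ⟨c₁, h₁⟩ := hL L₁ f
  obtain ⟨c₂, h₂⟩ := hL L₂ g
  have e : cov[L₁ ∘ X f, L₂ ∘ X g; μ] =
      cov[fun ω => (X (c₁ • f) ω).re, fun ω => (X (c₂ • g) ω).re; μ] := by
    rw [covariance, covariance, integral_congr_ae h₁, integral_congr_ae h₂]
    refine integral_congr_ae ?_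
    filter_upwards [h₁, h₂] with ω e₁ e₂
    rw [e₁, e₂]
  rw [e, covariance_re_coeFn hc, map_smul, map_smul, inner_smul_left,
    inner_smul_right, h]
  simp

lemma indepFun_of_inner_eq_zero (hg : IsGaussianProcess (fun f ω => X f ω) μ) (hc : IsCircular X)
    {S T : Type*} (f : S → V) (g : T → V) (h : ∀ s t, inner ℂ (X (f s)) (X (g t)) = 0) :
    IndepFun (fun ω s => X (f s) ω) (fun ω t => X (g t) ω) μ := by
  refine IsGaussianProcess.indepFun_of_covariance_strongDual (X := fun s ω => X (f s) ω)
    (Y := fun t ω => X (g t) ω) ?_ (fun s => (measurable_coeFn _).aemeasurable)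
    (fun t => (measurable_coeFn _).aemeasurable)
    fun s t L₁ L₂ => covariance_strongDual_eq_zero hc (h s t) L₁ L₂
  convert hg.comp_right (Sum.elim f g) using 1
  ext (s | t) ω <;> rfl

lemma iIndepFun_of_inner_eq_zero (hg : IsGaussianProcess (fun f ω => X f ω) μ) (hc : IsCircular X)
    {T : Type*} {S : T → Type*} (f : ∀ t, S t → V)
    (h : ∀ t t', t ≠ t' → ∀ s s', inner ℂ (X (f t s)) (X (f t' s')) = 0) :
    iIndepFun (fun t ω s => X (f t s) ω) μ :=
  IsGaussianProcess.iIndepFun_of_covariance_strongDual (X := fun t s ω => X (f t s) ω)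
    (hg.comp_right fun p : (t : T) × S t => f p.1 p.2)
    (fun _ _ => (measurable_coeFn _).aemeasurable)
    fun t t' ht s s' L₁ L₂ => covariance_strongDual_eq_zero hc (h t t' ht s s') L₁ L₂

end Independence

/-! ### The Markov property -/

section Markov

lemma sigmaOf_eq_comap {Ω G : Type*} [MeasurableSpace G] (X : ℤ → Ω → G) (S : Finset ℤ) :
    sigmaOf X S = MeasurableSpace.comap (fun ω (v : S) => X v ω) inferInstance := by
  rw [MeasurableSpace.pi, MeasurableSpace.comap_iSup, sigmaOf, iSup_subtype']
  simp only [MeasurableSpace.comap_comp]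
  rfl

variable {d : ℕ} {A : Matrix (Fin d ⊕ Fin d) (Fin d ⊕ Fin d) ℂ} {Ω : Type*} [MeasurableSpace Ω]
  {μ : Measure Ω} [IsProbabilityMeasure μ] {X : SymbolSpace d →ₗ[ℂ] Lp ℂ 2 μ}

/-- The Markov property for finitely many regions `V_i` with boundaries `B_i = V_i \ I_i`, such that
no region meets the interior `I_i` of another one. -/
lemma IsGaussianIsometry.condExp_prod_eq (hX : IsGaussianIsometry A μ X) (hA : A.PosDef)
    {ι : Type*} [Fintype ι] {V I : ι → Set ℤ} {B W : ι → Finset ℤ}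
    (hIV : ∀ i, I i ⊆ V i) (hI : ∀ i, ∀ a ∈ I i, a + 1 ∈ V i ∧ a - 1 ∈ V i)
    (hB : ∀ i b, b ∈ B i ↔ b ∈ V i ∧ b ∉ I i) (hW : ∀ i, ∀ v ∈ W i, v ∈ V i)
    (hsep : ∀ i j, i ≠ j → ∀ v ∈ V j, v ∉ I i)
    (h : ∀ i, (W i → Fin d → ℂ) → ℂ) (hh : ∀ i, Measurable (h i))
    (hb : ∀ i, ∃ c : ℝ, ∀ x, ‖h i x‖ ≤ c) :
    condExp (sigmaOf (gibbsProcess X) (Finset.univ.biUnion B)) μ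
        (fun ω => ∏ i, h i fun v => gibbsProcess X v ω)
      =ᵐ[μ] fun ω => ∏ i, condExp (sigmaOf (gibbsProcess X) (B i)) μ
        (fun ω' => h i fun v => gibbsProcess X v ω') ω := by
  have hreg : ∀ i (q : W i × Fin d), ∃ c : ℤ → Fin d → ℂ, ∀ b ∉ I i, ∀ k,
      symbolInner A (waveVec b k)
        (waveVec q.1 q.2 - ∑ b ∈ B i, ∑ k, c b k • waveVec b k) = 0 := fun i q =>
    exists_regression hA (hIV i) (hI i) (hB i) (hW i _ q.1.2) q.2
  choose c hc using hreg
  set n : ∀ i, W i × Fin d → SymbolSpace d := fun i q =>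
    waveVec q.1 q.2 - ∑ b ∈ B i, ∑ k, c i q b k • waveVec b k with hn
  have hBI : ∀ i j, ∀ b ∈ B i, b ∉ I j := fun i j b hbi => by
    by_cases hij : j = i
    · subst hij; exact ((hB j b).1 hbi).2
    · exact hsep j i hij b ((hB i b).1 hbi).1
  have hwn : ∀ i b, b ∉ I i → ∀ k q, inner ℂ (X (waveVec b k)) (X (n i q)) = 0 :=
    fun i b hb k q => by rw [hX.inner_map hA]; exact hc i q b hb k
  -- The noise of region i combines waves at sites of V_i. None of these sites is interior to V_j,
  -- so the noise of region j is orthogonal to all of them.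
  have hnn : ∀ i j, i ≠ j → ∀ q q', inner ℂ (X (n i q)) (X (n j q')) = 0 := fun i j hij q q' => by
    have e : n i q = waveVec q.1 q.2 - ∑ b ∈ B i, ∑ k, c i q b k • waveVec b k := rfl
    have h1 := hwn j q.1 (hsep j i hij.symm _ (hW i _ q.1.2)) q.2 q'
    rw [e, map_sub, inner_sub_left, h1, map_sum, sum_inner, zero_sub, neg_eq_zero]
    refine Finset.sum_eq_zero fun b hb => ?_
    rw [map_sum, sum_inner]
    refine Finset.sum_eq_zero fun k _ => ?_
    rw [map_smul, inner_smul_left, hwn j b (hBI i j b hb), mul_zero]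
  let Z : Ω → ↥(Finset.biUnion Finset.univ B) → Fin d → ℂ := fun ω b => gibbsProcess X b ω
  have hZ : Measurable Z := measurable_pi_lambda _ fun b => measurable_gibbsProcess _
  let p : ∀ i, (↥(Finset.biUnion Finset.univ B) → Fin d → ℂ) → B i → Fin d → ℂ :=
    fun i z b => z ⟨b, Finset.mem_biUnion.2 ⟨i, Finset.mem_univ i, b.2⟩⟩
  let R : ∀ i, Ω → W i × Fin d → ℂ := fun i ω q => X (n i q) ω
  -- F rebuilds the values at the sites of `W i` as regression on the boundary plus noise.
  let F : ∀ i, (B i → Fin d → ℂ) × (W i × Fin d → ℂ) → ℂ := fun i x =>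
    h i fun v j => ∑ b : B i, ∑ k, c i (v, j) b k * x.1 b k + x.2 (v, j)
  have hF : ∀ᵐ ω ∂μ, ∀ i, h i (fun v => gibbsProcess X v ω) = F i (p i (Z ω), R i ω) := by
    refine ae_all_iff.2 fun i => ?_
    have h1 : ∀ᵐ ω ∂μ, ∀ q : W i × Fin d, X (waveVec q.1 q.2) ω =
        ∑ b : B i, ∑ k, c i q b k * X (waveVec b k) ω + X (n i q) ω := by
      refine ae_all_iff.2 fun q => ?_
      have e : waveVec (q.1 : ℤ) q.2 =
          (∑ b : B i, ∑ k, c i q b k • waveVec (b : ℤ) k) + n i q := by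
        rw [Finset.sum_coe_sort (B i) fun b => ∑ k, c i q b k • waveVec b k, hn]
        exact (add_sub_cancel _ _).symm
      have e1 := Lp.coeFn_add (X (∑ b : B i, ∑ k, c i q b k • waveVec (b : ℤ) k)) (X (n i q))
      rw [← map_add, ← e] at e1
      filter_upwards [e1, coeFn_map_sum_sum X (fun (b : B i) k => c i q b k)
        fun b k => waveVec (b : ℤ) k] with ω h1 h2
      rw [h1, Pi.add_apply, h2]
    filter_upwards [h1] with ω h1
    refine congrArg (h i) (funext fun v => funext fun j => h1 (v, j))
  have hiR : iIndepFun R μ := iIndepFun_of_inner_eq_zero hX.gaussian hX.circular n hnn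
  have hZR : IndepFun Z (fun ω i => R i ω) μ := by
    have h1 := indepFun_of_inner_eq_zero hX.gaussian hX.circular
      (fun s : ↥(Finset.biUnion Finset.univ B) × Fin d => waveVec (s.1 : ℤ) s.2)
      (fun t : (i : ι) × (W i × Fin d) => n t.1 t.2) fun s t => by
        obtain ⟨i, -, hi⟩ := Finset.mem_biUnion.1 s.1.2
        exact hwn _ _ (hBI i t.1 _ hi) _ _
    exact h1.comp (φ := fun z b k => z (b, k)) (ψ := fun r i q => r ⟨i, q⟩) (by fun_prop)
      (by fun_prop)
  have hR : ∀ i, Measurable (R i) := fun i => measurable_pi_lambda _ fun q => measurable_coeFn _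
  have hp : ∀ i, Measurable (p i) := fun i => by fun_prop
  have key := condExp_prod_eq_prod_condExp hZ hp hR hiR hZR (F := F)
    (fun i => (hh i).comp (by fun_prop)) fun i => (hb i).imp fun c hc x => hc _
  have hL : (fun ω => ∏ i, h i fun v => gibbsProcess X v ω) =ᵐ[μ]
      fun ω => ∏ i, F i (p i (Z ω), R i ω) := by
    filter_upwards [hF] with ω hω
    exact Finset.prod_congr rfl fun i _ => hω i
  have hRi : ∀ᵐ ω ∂μ, ∀ i, condExp (sigmaOf (gibbsProcess X) (B i)) μ
        (fun ω' => h i fun v => gibbsProcess X v ω') ω =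
      condExp (sigmaOf (gibbsProcess X) (B i)) μ (fun ω' => F i (p i (Z ω'), R i ω')) ω := by
    refine ae_all_iff.2 fun i => condExp_congr_ae ?_
    filter_upwards [hF] with ω hω
    exact hω i
  have hs := sigmaOf_eq_comap (gibbsProcess X)
  filter_upwards [condExp_congr_ae (m := sigmaOf (gibbsProcess X) (Finset.univ.biUnion B)) hL,
    hRi, key] with ω e1 e2 e3
  rw [e1, Finset.prod_congr rfl fun i _ => e2 i]
  simp only [hs]
  exact e3

end Markov

/-! ### The Markov property on finite domains and at single sites -/

section Gibbs

lemma mem_vertices {D : Finset ℤ} {v : ℤ} : v ∈ vertices D ↔ v ∈ D ∨ v - 1 ∈ D := by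
  rw [vertices, Finset.mem_union, Finset.mem_image]
  refine or_congr_right ⟨?_, fun h => ⟨_, h, sub_add_cancel _ _⟩⟩
  rintro ⟨a, ha, rfl⟩
  rwa [add_sub_cancel_right]

lemma mem_boundary {D : Finset ℤ} {v : ℤ} :
    v ∈ boundary D ↔ (v ∈ D ∧ v - 1 ∉ D) ∨ (v ∉ D ∧ v - 1 ∈ D) := by
  rw [boundary, Finset.mem_filter, mem_vertices]
  tauto

variable {d : ℕ} {A : Matrix (Fin d ⊕ Fin d) (Fin d ⊕ Fin d) ℂ} {Ω : Type*} [MeasurableSpace Ω]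
  {μ : Measure Ω} [IsProbabilityMeasure μ] {X : SymbolSpace d →ₗ[ℂ] Lp ℂ 2 μ}

/-- The interior consists of the vertices both of whose edges lie in E_i. A vertex of E_j has an
edge in E_j, so by disjointness it cannot be interior to E_i. -/
lemma IsGaussianIsometry.isMarkovOn_gibbsProcess (hX : IsGaussianIsometry A μ X) (hA : A.PosDef)
    (D : Finset ℤ) : IsMarkovOn μ (gibbsProcess X) D := by
  intro n E _ hE _ h hh hb
  refine hX.condExp_prod_eq hA (V := fun i => {v | v ∈ vertices (E i)})
    (I := fun i => {v | v ∈ E i ∧ v - 1 ∈ E i}) (fun i v hv => mem_vertices.2 (.inl hv.1))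
    (fun i a ha => ⟨mem_vertices.2 (.inr (by simpa using ha.1)), mem_vertices.2 (.inl ha.2)⟩)
    (fun i b => ?_) (fun i v hv => hv) (fun i j hij v hv hvi => ?_) h hh hb
  · simp only [Set.mem_ofPred_eq, mem_boundary, mem_vertices]
    tauto
  · rcases mem_vertices.1 hv with h | h
    · exact Finset.disjoint_left.1 (hE hij) hvi.1 h
    · exact Finset.disjoint_left.1 (hE hij) hvi.2 h

/-- The two regions are the closed half-lines ending at m, with the open half-lines as interiors and
common boundary {m}. Infinite regions are admissible because only their boundaries have to be
finite. -/
lemma IsGaussianIsometry.splitsAtSites_gibbsProcess (hX : IsGaussianIsometry A μ X)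
    (hA : A.PosDef) : SplitsAtSites μ (gibbsProcess X) := by
  intro m S T hS hT f g hf hg hbf hbg
  let W : Bool → Finset ℤ := fun i => if i then S else T
  let h : ∀ i, (W i → Fin d → ℂ) → ℂ := fun i => match i with
    | true => f
    | false => g
  have key := hX.condExp_prod_eq hA (ι := Bool)
    (V := fun i => if i then {v | v ≤ m} else {v | m ≤ v})
    (I := fun i => if i then {v | v < m} else {v | m < v}) (B := fun _ => {m}) (W := W)
    (by
      rintro (_ | _) v hv <;> simp at hv ⊢ <;> omega)
    (by
      rintro (_ | _) v hv <;> simp at hv ⊢ <;> omega)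
    (by
      rintro (_ | _) v <;> simp <;> omega)
    (by
      rintro (_ | _) v hv
      · exact (hT v hv).le
      · exact (hS v hv).le)
    (by
      rintro (_ | _) (_ | _) hij v hv <;> simp at hij hv ⊢ <;> omega)
    h (by rintro (_ | _) <;> assumption) (by rintro (_ | _) <;> assumption)
  have hm : (Finset.univ.biUnion fun _ : Bool => ({m} : Finset ℤ)) = {m} := by
    ext; simp
  rw [hm] at key
  simp only [Fintype.prod_bool] at key
  exact key

lemma IsGaussianIsometry.isMarkov_gibbsProcess (hX : IsGaussianIsometry A μ X) (hA : A.PosDef) :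
    IsMarkov μ (gibbsProcess X) :=
  ⟨measurable_gibbsProcess, hX.isMarkovOn_gibbsProcess hA, hX.splitsAtSites_gibbsProcess hA⟩

end Gibbs

/-! ### Reflection of Markov processes -/

section Reflection

variable {Ω G : Type*} [MeasurableSpace Ω] [MeasurableSpace G] {μ : Measure Ω} {X : ℤ → Ω → G}
  {φ ψ : G → G}

/-- The left inverse ψ ensures that φ loses no information, so the σ-algebras coincide. -/
lemma sigmaOf_reflect {Ω : Type*} {X : ℤ → Ω → G} (hφ : Measurable φ) (hψ : Measurable ψ)
    (hψφ : Function.LeftInverse ψ φ) (S : Finset ℤ) :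
    sigmaOf (fun k ω => φ (X (-k) ω)) S = sigmaOf X (S.image Neg.neg) := by
  rw [sigmaOf, sigmaOf, Finset.iSup_finset_image]
  refine iSup_congr fun v => iSup_congr fun _ => le_antisymm ?_ ?_
  · change MeasurableSpace.comap (φ ∘ X (-v)) _ ≤ _
    rw [← MeasurableSpace.comap_comp]
    exact MeasurableSpace.comap_mono hφ.comap_le
  · have h : X (-v) = ψ ∘ fun ω => φ (X (-v) ω) := funext fun ω => (hψφ _).symm
    conv_lhs => rw [h, ← MeasurableSpace.comap_comp]
    exact MeasurableSpace.comap_mono hψ.comap_le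

lemma mem_image_neg {S : Finset ℤ} {v : ℤ} : v ∈ S.image Neg.neg ↔ -v ∈ S := by
  simp [Finset.mem_image, neg_eq_iff_eq_neg]

/-- The reflection sends the edge {e, e + 1} to {-e - 1, -e}, whose left vertex is -e - 1. -/
lemma mem_image_reflect {D : Finset ℤ} {v : ℤ} :
    v ∈ D.image (fun e => -e - 1) ↔ -v - 1 ∈ D := by
  rw [Finset.mem_image]
  constructor
  · rintro ⟨a, ha, rfl⟩
    simpa using ha
  · exact fun h => ⟨_, h, by ring⟩

lemma vertices_image_reflect (D : Finset ℤ) :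
    vertices (D.image fun e => -e - 1) = (vertices D).image Neg.neg := by
  ext v
  rw [mem_vertices, mem_image_neg, mem_vertices, mem_image_reflect, mem_image_reflect,
    show -(v - 1) - 1 = -v by ring, or_comm]

lemma boundary_image_reflect (D : Finset ℤ) :
    boundary (D.image fun e => -e - 1) = (boundary D).image Neg.neg := by
  ext v
  rw [mem_boundary, mem_image_neg, mem_boundary, mem_image_reflect, mem_image_reflect,
    show -(v - 1) - 1 = -v by ring]
  tauto

lemma IsMarkov.reflect (hX : IsMarkov μ X) (hφ : Measurable φ) (hψ : Measurable ψ)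
    (hψφ : Function.LeftInverse ψ φ) : IsMarkov μ fun k ω => φ (X (-k) ω) := by
  refine ⟨fun k => hφ.comp (hX.1 _), ?_, ?_⟩
  · intro D n E hne hdisj _ h hh hb
    let E' : Fin n → Finset ℤ := fun i => (E i).image fun e => -e - 1
    have hmem : ∀ i, ∀ v ∈ vertices (E i), -v ∈ vertices (E' i) := fun i v hv => by
      rw [vertices_image_reflect, mem_image_neg, neg_neg]
      exact hv
    have key := hX.2.1 _ n E' (fun i => (hne i).image _)
      (fun i j hij => (Finset.disjoint_image fun a b hab => by
        simpa using hab).2 (hdisj hij)) rfl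
      (fun i x => h i fun v => φ (x ⟨-v, hmem i v v.2⟩))
      (fun i => (hh i).comp (measurable_pi_lambda _ fun v => hφ.comp (measurable_pi_apply _)))
      fun i => (hb i).imp fun c hc x => hc _
    have hU : (Finset.univ.biUnion fun i => boundary (E' i)) =
        (Finset.univ.biUnion fun i => boundary (E i)).image Neg.neg := by
      ext v
      simp only [E', boundary_image_reflect, Finset.mem_biUnion, mem_image_neg]
    rw [hU] at key
    simp only [sigmaOf_reflect hφ hψ hψφ]
    simpa only [E', boundary_image_reflect] using key
  · intro m S T hS hT f g hf hg hbf hbg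
    have hmem : ∀ (S : Finset ℤ), ∀ v ∈ S, -v ∈ S.image Neg.neg := fun S v hv =>
      Finset.mem_image_of_mem _ hv
    -- Reflection exchanges past and future, so the roles of S and T, and of f and g, are swapped.
    have key := hX.2.2 (-m) (T.image Neg.neg) (S.image Neg.neg)
      (fun k hk => by have := hT _ (mem_image_neg.1 hk); omega)
      (fun k hk => by have := hS _ (mem_image_neg.1 hk); omega)
      (fun x => g fun v => φ (x ⟨-v, hmem T v v.2⟩)) (fun x => f fun v => φ (x ⟨-v, hmem S v v.2⟩))
      (hg.comp (measurable_pi_lambda _ fun v => hφ.comp (measurable_pi_apply _)))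
      (hf.comp (measurable_pi_lambda _ fun v => hφ.comp (measurable_pi_apply _)))
      (hbg.imp fun c hc x => hc _) (hbf.imp fun c hc x => hc _)
    simp only [sigmaOf_reflect hφ hψ hψφ, Finset.image_singleton]
    simpa only [mul_comm] using key

end Reflection

/-! ### The Markov property of the thermodynamic limit -/

section Limit

variable {d : ℕ} {Ω : Type*} [MeasurableSpace Ω] {μ : Measure Ω}
  {X : SymbolSpace d →ₗ[ℂ] Lp ℂ 2 μ}

lemma isMarkov_limitProcess (hX : IsMarkov μ (gibbsProcess X)) : IsMarkov μ (limitProcess X) := by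
  refine hX.reflect (φ := fun x i => (Real.sqrt 2 : ℂ) * star (x i))
    (ψ := fun x i => star ((Real.sqrt 2 : ℂ)⁻¹ * x i)) (Continuous.measurable (by fun_prop))
    (Continuous.measurable (by fun_prop)) fun x => funext fun i => ?_
  have h : (Real.sqrt 2 : ℂ) ≠ 0 := Complex.ofReal_ne_zero.2 (by positivity)
  simp only [inv_mul_cancel_left₀ h, star_star]

end Limit

end GaussMarkov

end

theorem theorem3p2 (d : ℕ) (hd : 1 ≤ d)
    (A : Matrix (Fin d ⊕ Fin d) (Fin d ⊕ Fin d) ℂ) (hA : A.PosDef) :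
    -- the periodic laws are probability measures, and their finite-dimensional characteristic
    -- functions converge
    (∀ P : ℕ, IsProbabilityMeasure (GaussMarkov.periodicLaw A (P + 1))) ∧
    (∀ α : ℤ →₀ (Fin d → ℂ),
      Tendsto
        (fun P : ℕ => ∫ x, Complex.exp (Complex.I *
            ((α.sum fun k a => star a ⬝ᵥ x (k : ZMod (P + 1))).re : ℂ))
          ∂(GaussMarkov.periodicLaw A (P + 1)))
        atTop
        (𝓝 (Complex.exp (-(1 / 2) * α.sum fun k a => α.sum fun l b =>
          star a ⬝ᵥ (GaussMarkov.invCoeff A (l - k)).mulVec b)))) ∧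
    -- a Gaussian isometry exists
    (∃ (Ω : Type) (_ : MeasurableSpace Ω) (μ : Measure Ω) (_ : IsProbabilityMeasure μ)
      (X : GaussMarkov.SymbolSpace d →ₗ[ℂ] Lp ℂ 2 μ), GaussMarkov.IsGaussianIsometry A μ X) ∧
    -- and the process defined by any such isometry has the stated properties
    (∀ (Ω : Type*) [MeasurableSpace Ω] (μ : Measure Ω) [IsProbabilityMeasure μ]
      (X : GaussMarkov.SymbolSpace d →ₗ[ℂ] Lp ℂ 2 μ), GaussMarkov.IsGaussianIsometry A μ X →
      IsGaussianProcess (GaussMarkov.gibbsProcess X) μ ∧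
      GaussMarkov.IsTranslationInvariant μ (GaussMarkov.gibbsProcess X) ∧
      (∀ (k l : ℤ) (i j : Fin d),
        Integrable (fun ω => GaussMarkov.gibbsProcess X k ω i *
          star (GaussMarkov.gibbsProcess X l ω j)) μ ∧
        ∫ ω, GaussMarkov.gibbsProcess X k ω i * star (GaussMarkov.gibbsProcess X l ω j) ∂μ
          = GaussMarkov.invCoeff A (l - k) j i) ∧
      GaussMarkov.IsThermodynamicLimit A μ (GaussMarkov.limitProcess X) ∧
      GaussMarkov.IsMarkov μ (GaussMarkov.gibbsProcess X) ∧
      GaussMarkov.IsMarkov μ (GaussMarkov.limitProcess X)) := by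
  refine ⟨fun P => GaussMarkov.isProbabilityMeasure_periodicLaw hA,
    GaussMarkov.tendsto_charFun_periodicLaw hA, GaussMarkov.exists_isGaussianIsometry hA,
    fun Ω _ μ _ X hX => ⟨hX.isGaussianProcess_gibbsProcess,
      hX.isTranslationInvariant_gibbsProcess hA, hX.integrable_and_integral_mul_star hA,
      hX.isThermodynamicLimit_limitProcess hA, hX.isMarkov_gibbsProcess hA,
      GaussMarkov.isMarkov_limitProcess (hX.isMarkov_gibbsProcess hA)⟩⟩
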